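/- Let $\mathbf g$ be a complex Lie algebra with an invariant symmetric bilinear form $(\cdot,\cdot)$, let $\mathcal K$ be the field of meromorphic functions on $\mathbb P=\mathbb P^1(\mathbb C)$, and let $\mathfrak g=\mathbf g\otimes_{\mathbb C}\mathcal K$ be the Lie algebra of meromorphic maps $\mathbb P\to\mathbf g$, with pointwise bracket; $\mathbf g\subset\mathfrak g$ is the subalgebra of constant maps. Let $z_1,\dots,z_n\in\mathbb P$ be distinct points, let $W_1,\dots,W_n$ be representations of $\mathbf g$, and put $$\mathcal W=U\mathfrak g\otimes_{U\mathbf g}(W_1\otimes\cdots\otimes W_n),$$ where $\mathbf g$ acts diagonally on the tensor product; an element $\alpha\in\mathfrak g$ also denotes the operator of left multiplication by $\alpha$ on $\mathcal W$. Write $v^{(j)}$ for the action of $v\in\mathbf g$ on the $j$-th factor of $W_1\otimes\cdots\otimes W_n$, and for $\mu,\nu\in\mathfrak g$ write $\mathrm{Res}_{z}(\mu,d\nu)$ for the residue at $z$ of the meromorphic one-form $(\mu,d\nu)$. Theorem. For each $l=1,\dots,n$ there is a unique family of operators $J_l^\nu:\mathcal W\to\mathcal W$, linear in $\nu\in\mathfrak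 g$, such that for all $\nu,\alpha\in\mathfrak g$ and all $\mathbf w=w_1\otimes\cdots\otimes w_n$, $$[J_l^\nu,\alpha]=\mathrm{Res}_{z_l}(\nu,d\alpha)+J_l^{[\nu,\alpha]},$$ $$J_l^\nu(1\otimes\mathbf w)=\nu\otimes\mathbf w-\sum_{j\ne l}1\otimes\nu(z_j)^{(j)}\mathbf w\quad\text{if }\nu\text{ is regular away from }z_l,$$ $$J_l^\nu(1\otimes\mathbf w)=1\otimes\nu(z_l)^{(l)}\mathbf w\quad\text{if }\nu\text{ is regular at }z_l.$$ These loop operators have the following properties. (a) Loop operators around different insertion points commute: $[J_l^{\nu_1},J_m^{\nu_2}]=0$ for all $l\ne m$ and all $\nu_1,\nu_2\in\mathfrak g$. (b) Around a single point, $[J_l^\mu,J_l^\nu]-J_l^{[\mu,\nu]}=\mathrm{Res}_{z_l}(\mu,d\nu)\cdot\mathrm{id}_{\mathcal W}$ for all $\mu,\nu\in\mathfrak g$. In particular the left side is $0$ if $\mu$ and $\nu$ are both regular at $z_l$, or both regular away from $z_l$. (c) For each $l$, the form $(\mu,\nu)\mapsto\mathrm{Res}_{z_l}(\mu,d\nu)$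 is a $2$-cocycle on $\mathfrak g$ with values in $\mathbb C$, and $(\nu,a)\mapsto J_l^\nu+a\cdot\mathrm{id}_{\mathcal W}$ is a representation on $\mathcal W$ of the central extension $\mathfrak g\oplus\mathbb C$ of $\mathfrak g=\mathbf g\otimes\mathcal K$ that this cocycle defines. -/

import Mathlib

open scoped TensorProduct

/- The commutator bracket on an associative ring. -/
attribute [local instance 100] LieRing.ofAssociativeRing

noncomputable section

namespace LoopCurrent

/-! ### Rational functions on the projective line

The projective line is `OnePoint ℂ = ℂ ∪ {∞}`, and its field of meromorphic functions is
`RatFunc ℂ`; the variable `RatFunc.X` is the standard coordinate `u`. -/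

/-- The coordinate `u` written in the standard local parameter `t` at a point:
`u = a + t` at a finite point `a`, and `u = t⁻¹` at `∞`. -/
def localCoord : OnePoint ℂ → LaurentSeries ℂ
  | some a => HahnSeries.single 0 a + HahnSeries.single 1 1
  | none => HahnSeries.single (-1) 1

theorem algebraMap_laurent (c : ℂ) :
    algebraMap ℂ (LaurentSeries ℂ) c = HahnSeries.single 0 c := by
  rw [HahnSeries.algebraMap_apply', PowerSeries.algebraMap_apply]
  simp

theorem transcendental_localCoord (p : OnePoint ℂ) : Transcendental ℂ (localCoord p) := by
  intro h
  obtain ⟨c, hc⟩ := (IsAlgClosed.algebraMap_bijective_of_isIntegral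
    (k := ℂ) (K := integralClosure ℂ (LaurentSeries ℂ))).2 ⟨localCoord p, h.isIntegral⟩
  have hc' : algebraMap ℂ (LaurentSeries ℂ) c = localCoord p := congrArg Subtype.val hc
  rw [algebraMap_laurent] at hc'
  cases p with
  | infty =>
    have := congrArg (fun f : LaurentSeries ℂ => f.coeff (-1)) hc'
    simp [localCoord] at this
  | coe a =>
    have := congrArg (fun f : LaurentSeries ℂ => f.coeff 1) hc'
    simp [localCoord] at this

/-- Laurent expansion at a point of the projective line, in the standard local parameter: the
unique homomorphism of `ℂ`-algebras that sends the coordinate `u` to `localCoord p`. -/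
def expand (p : OnePoint ℂ) : RatFunc ℂ →ₐ[ℂ] LaurentSeries ℂ :=
  RatFunc.liftAlgHom (Polynomial.aeval (localCoord p))
    (nonZeroDivisors_le_comap_nonZeroDivisors_of_injective _
      (transcendental_iff_injective.mp (transcendental_localCoord p)))

theorem coeff_expand_smul (p : OnePoint ℂ) (c : ℂ) (f : RatFunc ℂ) (n : ℤ) :
    (expand p (c • f)).coeff n = c * (expand p f).coeff n := by
  rw [Algebra.smul_def, map_mul, AlgHom.commutes, algebraMap_laurent, HahnSeries.coeff_single_zero_mul]

theorem expand_smul (p : OnePoint ℂ) (c : ℂ) (f : RatFunc ℂ) :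
    expand p (c • f) = HahnSeries.single 0 c * expand p f := by
  rw [Algebra.smul_def, map_mul, AlgHom.commutes, algebraMap_laurent]

theorem derivative_single_zero_mul (c : ℂ) (F : LaurentSeries ℂ) :
    LaurentSeries.derivative ℂ (HahnSeries.single 0 c * F) =
      HahnSeries.single 0 c * LaurentSeries.derivative ℂ F := by
  ext n
  simp

/-- The local ring at `p`: rational functions without a pole at `p`. -/
def regularFns (p : OnePoint ℂ) : Submodule ℂ (RatFunc ℂ) where
  carrier := {f | ∀ n : ℤ, n < 0 → (expand p f).coeff n = 0}
  add_mem' hf hg n hn := by simp [hf n hn, hg n hn]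
  zero_mem' n _ := by simp
  smul_mem' c f hf n hn := by rw [coeff_expand_smul, hf n hn, mul_zero]

/-- The constant term of the expansion at `p`; it is the value `f(p)` when `f` is regular at `p`
(and is only ever used then). -/
def evalFn (p : OnePoint ℂ) : RatFunc ℂ →ₗ[ℂ] ℂ where
  toFun f := (expand p f).coeff 0
  map_add' f g := by simp
  map_smul' c f := coeff_expand_smul p c f 0

/-- `resForm p f g = Res_p (f dg)`, the coefficient of `t⁻¹ dt` in the expansion of `f dg`. -/
def resForm (p : OnePoint ℂ) : LinearMap.BilinForm ℂ (RatFunc ℂ) :=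
  LinearMap.mk₂ ℂ
    (fun f g => (expand p f * LaurentSeries.derivative ℂ (expand p g)).coeff (-1))
    (fun f f' g => by simp [add_mul])
    (fun c f g => by
      rw [expand_smul, mul_assoc, HahnSeries.coeff_single_zero_mul, smul_eq_mul])
    (fun f g g' => by simp only [map_add, mul_add, HahnSeries.coeff_add])
    (fun c f g => by
      rw [expand_smul, derivative_single_zero_mul, mul_left_comm,
        HahnSeries.coeff_single_zero_mul, smul_eq_mul])

/-! ### Meromorphic maps to a Lie algebra -/

section Current

variable (𝔤 : Type*) [LieRing 𝔤] [LieAlgebra ℂ 𝔤]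

/-- The Lie algebra of meromorphic maps from the projective line to `𝔤`, with pointwise bracket
`⁅f ⊗ v, g ⊗ w⁆ = fg ⊗ ⁅v, w⁆`. -/
abbrev Current : Type _ := RatFunc ℂ ⊗[ℂ] 𝔤

/-- `𝔤` as the subalgebra of constant maps. -/
def const : 𝔤 →ₗ⁅ℂ⁆ Current 𝔤 where
  toLinearMap := TensorProduct.mk ℂ (RatFunc ℂ) 𝔤 1
  map_lie' {x y} := by simp

/-- The homomorphism of enveloping algebras induced by the inclusion of constant maps. -/
def constU : UniversalEnvelopingAlgebra ℂ 𝔤 →ₐ[ℂ] UniversalEnvelopingAlgebra ℂ (Current 𝔤) :=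
  UniversalEnvelopingAlgebra.lift ℂ ((UniversalEnvelopingAlgebra.ι ℂ).comp (const 𝔤))

variable {𝔤}

/-- `ν` is regular at `p`: it lies in `𝒪_p ⊗ 𝔤`. -/
def RegularAt (p : OnePoint ℂ) (ν : Current 𝔤) : Prop :=
  ν ∈ LinearMap.range ((regularFns p).subtype.rTensor 𝔤)

/-- `ν` is regular away from `p`. -/
def RegularAwayFrom (p : OnePoint ℂ) (ν : Current 𝔤) : Prop :=
  ∀ q : OnePoint ℂ, q ≠ p → RegularAt q ν

/-- The value at `p` of a map that is regular at `p`. -/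
def evalAt (p : OnePoint ℂ) : Current 𝔤 →ₗ[ℂ] 𝔤 :=
  (TensorProduct.lid ℂ 𝔤).toLinearMap ∘ₗ (evalFn p).rTensor 𝔤

/-- `resPairing B p μ ν = Res_p (μ, dν)` for the bilinear form `( , ) = B`:
on pure tensors, `(f ⊗ v, g ⊗ w) ↦ Res_p (f dg) * B v w`. -/
def resPairing (B : LinearMap.BilinForm ℂ 𝔤) (p : OnePoint ℂ) :
    LinearMap.BilinForm ℂ (Current 𝔤) :=
  (resForm p).tmul B

end Current

/-! ### The induced module -/

section Induced

variable {𝔤 : Type*} [LieRing 𝔤] [LieAlgebra ℂ 𝔤] {n : ℕ}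
  (W : Fin n → Type*) [∀ j, AddCommGroup (W j)] [∀ j, Module ℂ (W j)]
  [∀ j, LieRingModule 𝔤 (W j)] [∀ j, LieModule ℂ 𝔤 (W j)]

/-- The action of `𝔤` on the `j`-th tensor factor:
`w₁ ⊗ ⋯ ⊗ wₙ ↦ w₁ ⊗ ⋯ ⊗ v(wⱼ) ⊗ ⋯ ⊗ wₙ`. -/
def actAt (j : Fin n) : 𝔤 →ₗ[ℂ] Module.End ℂ (⨂[ℂ] i, W i) where
  toFun v := PiTensorProduct.map
    (Function.update (fun i => (LinearMap.id : W i →ₗ[ℂ] W i)) j (LieModule.toEnd ℂ 𝔤 (W j) v))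
  map_add' v v' := by rw [map_add, PiTensorProduct.map_update_add]
  map_smul' c v := by rw [map_smul, PiTensorProduct.map_update_smul]; rfl

theorem actAt_tprod (j : Fin n) (v : 𝔤) (w : ∀ i, W i) :
    actAt W j v (PiTensorProduct.tprod ℂ w) =
      PiTensorProduct.tprod ℂ (Function.update w j ⁅v, w j⁆) := by
  simp only [actAt, LinearMap.coe_mk, AddHom.coe_mk, PiTensorProduct.map_tprod]
  congr 1
  funext i
  by_cases h : i = j
  · subst h; simp
  · simp [h]

theorem actAt_lie (i j : Fin n) (v v' : 𝔤) :
    ⁅actAt W i v, actAt W j v'⁆ = if i = j then actAt W i ⁅v, v'⁆ else 0 := by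
  refine PiTensorProduct.ext (MultilinearMap.ext fun w => ?_)
  simp only [LinearMap.compMultilinearMap_apply, LieRing.of_associative_ring_bracket,
    LinearMap.sub_apply, Module.End.mul_apply, actAt_tprod]
  split_ifs with h
  · subst h
    simp only [actAt_tprod, Function.update_self, Function.update_idem, lie_lie,
      MultilinearMap.map_update_sub]
  · rw [Function.update_of_ne (Ne.symm h), Function.update_of_ne h, Function.update_comm h]
    simp

/-- The diagonal action of `𝔤` on `W₁ ⊗ ⋯ ⊗ Wₙ`. -/
def diag : 𝔤 →ₗ⁅ℂ⁆ Module.End ℂ (⨂[ℂ] i, W i) where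
  toLinearMap := ∑ j, actAt W j
  map_lie' {x y} := by
    change (∑ j, actAt W j) ⁅x, y⁆ = ⁅(∑ j, actAt W j) x, (∑ j, actAt W j) y⁆
    simp only [LinearMap.sum_apply, LieRing.of_associative_ring_bracket, Finset.sum_mul_sum]
    rw [Finset.sum_comm (f := fun i j => actAt W i y * actAt W j x), ← Finset.sum_sub_distrib]
    refine Finset.sum_congr rfl fun i _ => ?_
    rw [← Finset.sum_sub_distrib, Finset.sum_congr rfl fun j _ =>
      (LieRing.of_associative_ring_bracket _ _).symm.trans (actAt_lie W i j x y)]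
    simp

variable (𝔤)

/-- The relations `a b ⊗ t = a ⊗ b t`, for `b` in the enveloping algebra of `𝔤`. -/
def balancing : Submodule ℂ
    (UniversalEnvelopingAlgebra ℂ (Current 𝔤) ⊗[ℂ] (⨂[ℂ] i, W i)) :=
  Submodule.span ℂ {x | ∃ (a : UniversalEnvelopingAlgebra ℂ (Current 𝔤))
    (b : UniversalEnvelopingAlgebra ℂ 𝔤) (t : ⨂[ℂ] i, W i),
    x = (a * constU 𝔤 b) ⊗ₜ[ℂ] t -
      a ⊗ₜ[ℂ] (UniversalEnvelopingAlgebra.lift ℂ (diag W) b t)}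

/-- The induced module: the tensor product of `U(Current 𝔤)` with `W₁ ⊗ ⋯ ⊗ Wₙ` over `U𝔤`. -/
abbrev InducedModule : Type _ :=
  (UniversalEnvelopingAlgebra ℂ (Current 𝔤) ⊗[ℂ] (⨂[ℂ] i, W i)) ⧸ balancing 𝔤 W

/-- Left multiplication by an element of the enveloping algebra on the induced module. -/
def leftMul (a : UniversalEnvelopingAlgebra ℂ (Current 𝔤)) :
    Module.End ℂ (InducedModule 𝔤 W) :=
  Submodule.mapQ _ _ ((LinearMap.mulLeft ℂ a).rTensor (⨂[ℂ] i, W i)) (by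
    refine Submodule.span_le.mpr ?_
    rintro _ ⟨a', b, t, rfl⟩
    refine Submodule.subset_span ⟨a * a', b, t, ?_⟩
    simp [mul_assoc])

/-- The map `t ↦ 1 ⊗ t` to the induced module. -/
def vac : (⨂[ℂ] i, W i) →ₗ[ℂ] InducedModule 𝔤 W :=
  (balancing 𝔤 W).mkQ ∘ₗ
    TensorProduct.mk ℂ (UniversalEnvelopingAlgebra ℂ (Current 𝔤)) (⨂[ℂ] i, W i) 1

variable {𝔤}

/-- The equations that define the loop operators `ν ↦ J_l^ν` around the `l`-th insertion point
`z l`, on the induced module. -/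
structure IsLoopOperator (B : LinearMap.BilinForm ℂ 𝔤) (z : Fin n → OnePoint ℂ) (l : Fin n)
    (J : Current 𝔤 →ₗ[ℂ] Module.End ℂ (InducedModule 𝔤 W)) : Prop where
  /-- `[J^ν, α] = Res_{z l} (ν, dα) + J^[ν, α]`, where `α` acts by left multiplication. -/
  commutator : ∀ ν α : Current 𝔤,
    ⁅J ν, leftMul 𝔤 W (UniversalEnvelopingAlgebra.ι ℂ α)⁆ =
      resPairing B (z l) ν α • (1 : Module.End ℂ (InducedModule 𝔤 W)) + J ⁅ν, α⁆
  /-- If `ν` is regular away from `z l`, then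
  `J^ν (w₁ ⊗ ⋯ ⊗ wₙ) = ν ⊗ (w₁ ⊗ ⋯ ⊗ wₙ) - ∑_{j ≠ l} w₁ ⊗ ⋯ ⊗ ν(z j)(wⱼ) ⊗ ⋯ ⊗ wₙ`. -/
  regular_away : ∀ ν : Current 𝔤, RegularAwayFrom (z l) ν → ∀ w : ∀ j, W j,
    J ν (vac 𝔤 W (PiTensorProduct.tprod ℂ w)) =
      leftMul 𝔤 W (UniversalEnvelopingAlgebra.ι ℂ ν) (vac 𝔤 W (PiTensorProduct.tprod ℂ w)) -
        ∑ j ∈ Finset.univ.erase l,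
          vac 𝔤 W (actAt W j (evalAt (z j) ν) (PiTensorProduct.tprod ℂ w))
  /-- If `ν` is regular at `z l`, then `J^ν (w₁ ⊗ ⋯ ⊗ wₙ) = w₁ ⊗ ⋯ ⊗ ν(z l)(w_l) ⊗ ⋯ ⊗ wₙ`. -/
  regular_at : ∀ ν : Current 𝔤, RegularAt (z l) ν → ∀ w : ∀ j, W j,
    J ν (vac 𝔤 W (PiTensorProduct.tprod ℂ w)) =
      vac 𝔤 W (actAt W l (evalAt (z l) ν) (PiTensorProduct.tprod ℂ w))

end Induced

end LoopCurrent

end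

noncomputable section
namespace LoopCurrent

/-! ### Laurent series -/

/-! Fix `p = z l`. Every meromorphic map is the sum of one regular away from `p` and one regular at
`p`, and the overlap consists of the constants. The two prescribed formulas therefore determine
`J^ν` on the vectors `1 ⊗ t`. They agree on constants, because `v ⊗ t = 1 ⊗ (∑ j, v^{(j)}) t` in the
induced module (`awayMap_const`). Since these vectors generate the module, the commutator relation
gives uniqueness.

For existence, the commutator relation describes how the pair `(x, ν ↦ J^ν x)` changes when `x` is
replaced by `α x`. This is an action of the currents on `M × Hom(L, M)`, with `L` the currents and
`M` the induced module; it is a representation because the residue pairing is a skew 2-cocycle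
(`cocycleRep`). By Frobenius reciprocity a `𝔤`-equivariant map from `W₁ ⊗ ⋯ ⊗ Wₙ` to this
representation extends to the induced module. Equivariance holds when polar parts are chosen to
commute with brackets by constants (`exists_extension`, `exists_polarPart_current`).

Both commutation relations propagate from `x` to `α x` when they are assumed for all pairs of
currents at once; for a single point this uses the Jacobi and cocycle identities. So it suffices to
check them on `1 ⊗ t`, with each current regular at its point or away from it. Actions on different
tensor factors commute, which settles most terms. The residues enter as follows. If both currents
have poles only at `p`, the residue at `p` vanishes. If they have poles only at `p` and only at `q`
respectively, the residues at `p` and `q` cancel (`resForm_add_resForm`).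

These residue statements are algebraic. Functions with poles only at `p` are polynomials in a
function `y` with a simple pole at `p` and a simple zero at `q`; those with poles only at `q` are
polynomials in `y⁻¹`. All forms `y^k dy` are exact except `dy / y`, whose residues at `p` and `q`
are `-1` and `1`. -/

theorem coeff_derivative (F : LaurentSeries ℂ) (n : ℤ) :
    (LaurentSeries.derivative ℂ F).coeff n = (n + 1) * F.coeff (n + 1) := by
  rw [LaurentSeries.derivative_apply, LaurentSeries.hasseDeriv_coeff]
  simp

theorem support_derivative_subset (F : LaurentSeries ℂ) :
    (HahnSeries.single (1 : ℤ) (1 : ℂ) * LaurentSeries.derivative ℂ F).support ⊆ F.support := by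
  intro n hn h
  refine hn ?_
  have h' : F.coeff n = 0 := by simpa using h
  have := HahnSeries.coeff_single_mul_add (r := (1 : ℂ)) (x := LaurentSeries.derivative ℂ F)
    (a := n - 1) (b := 1)
  rw [sub_add_cancel] at this
  rw [this, coeff_derivative]
  simp [h']

theorem coeff_euler (F : LaurentSeries ℂ) (n : ℤ) :
    (HahnSeries.single (1 : ℤ) (1 : ℂ) * LaurentSeries.derivative ℂ F).coeff n =
      n * F.coeff n := by
  have := HahnSeries.coeff_single_mul_add (r := (1 : ℂ)) (x := LaurentSeries.derivative ℂ F)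
    (a := n - 1) (b := 1)
  rw [sub_add_cancel] at this
  rw [this, coeff_derivative]
  simp

/-- The Leibniz rule for formal Laurent series. -/
theorem derivative_mul (F G : LaurentSeries ℂ) :
    LaurentSeries.derivative ℂ (F * G) =
      LaurentSeries.derivative ℂ F * G + F * LaurentSeries.derivative ℂ G := by
  have ht : (HahnSeries.single (1 : ℤ) (1 : ℂ)) ≠ 0 := by simp
  -- After multiplication by `t` the derivative becomes the Euler operator, which multiplies the
  -- `n`-th coefficient by `n`. The rule then reduces to `n = i + j` in each term of the
  -- convolution; the Euler operator does not enlarge supports, so all three sums run over the same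
  -- index set.
  refine mul_left_cancel₀ ht ?_
  rw [mul_add, ← mul_assoc, mul_left_comm _ F]
  ext n
  rw [coeff_euler, HahnSeries.coeff_add,
    HahnSeries.coeff_mul_left' F.isPWO_support (support_derivative_subset F),
    HahnSeries.coeff_mul_right' G.isPWO_support (support_derivative_subset G),
    HahnSeries.coeff_mul, Finset.mul_sum, ← Finset.sum_add_distrib]
  refine Finset.sum_congr rfl fun ij hij => ?_
  have h : ij.1 + ij.2 = n := (Finset.mem_antidiagonal.mp hij).2.2
  rw [coeff_euler, coeff_euler, ← h]
  push_cast
  ring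

/-- A Laurent series without negative terms is a power series. -/
theorem exists_powerSeries {F : LaurentSeries ℂ} (hF : ∀ n : ℤ, n < 0 → F.coeff n = 0) :
    ∃ f : PowerSeries ℂ, (f : LaurentSeries ℂ) = F := by
  refine ⟨PowerSeries.mk fun n => F.coeff n, ?_⟩
  ext n
  rw [PowerSeries.coeff_coe]
  split_ifs with h
  · exact (hF n h).symm
  · rw [PowerSeries.coeff_mk, Int.natAbs_of_nonneg (not_lt.mp h)]

theorem coeff_coe_of_neg (f : PowerSeries ℂ) {n : ℤ} (hn : n < 0) :
    (f : LaurentSeries ℂ).coeff n = 0 := by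
  rw [PowerSeries.coeff_coe, if_pos hn]

theorem coeff_coe_zero (f : PowerSeries ℂ) :
    (f : LaurentSeries ℂ).coeff 0 = PowerSeries.constantCoeff f := by
  rw [PowerSeries.coeff_coe]
  simp

theorem order_nonneg_iff {F : LaurentSeries ℂ} :
    0 ≤ F.order ↔ ∀ n : ℤ, n < 0 → F.coeff n = 0 := by
  constructor
  · exact fun h n hn => HahnSeries.coeff_eq_zero_of_lt_order (hn.trans_le h)
  · intro h
    by_cases hF : F = 0
    · simp [hF]
    · by_contra! hlt
      exact hF (HahnSeries.coeff_order_eq_zero.mp (h _ hlt))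

/-- The residue of a logarithmic derivative is the order of vanishing. -/
theorem coeff_inv_mul_derivative {F : LaurentSeries ℂ} (hF : F ≠ 0) (h0 : F.order ≠ 0) :
    (F⁻¹ * LaurentSeries.derivative ℂ F).coeff (-1) = F.order := by
  have hc : F.coeff F.order ≠ 0 := mt HahnSeries.coeff_order_eq_zero.mp hF
  have hinv : F⁻¹.order + F.order = 0 := by
    rw [← HahnSeries.order_mul (inv_ne_zero hF) hF, inv_mul_cancel₀ hF, HahnSeries.order_one]
  have hcoef : (LaurentSeries.derivative ℂ F).coeff (F.order - 1) = F.order * F.coeff F.order := by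
    rw [coeff_derivative]; simp
  have hne : (LaurentSeries.derivative ℂ F).coeff (F.order - 1) ≠ 0 := by
    rw [hcoef]
    exact mul_ne_zero (by exact_mod_cast h0) hc
  have hD : (LaurentSeries.derivative ℂ F).order = F.order - 1 := by
    refine le_antisymm (HahnSeries.order_le_of_coeff_ne_zero hne) ?_
    refine (HahnSeries.le_order_iff_forall fun h => hne (by simp [h])).mpr fun j hj => ?_
    rw [coeff_derivative, HahnSeries.coeff_eq_zero_of_lt_order (by omega), mul_zero]
  -- Leading coefficients multiply. Comparing `F⁻¹ * F'` with `F⁻¹ * F = 1` leaves the factor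
  -- `F.order`; the assumption `h0` ensures that differentiation lowers the order by exactly one.
  have h1 := HahnSeries.coeff_mul_order_add_order F⁻¹ (LaurentSeries.derivative ℂ F)
  have h2 := HahnSeries.coeff_mul_order_add_order F⁻¹ F
  rw [inv_mul_cancel₀ hF, hinv, HahnSeries.leadingCoeff_eq, HahnSeries.leadingCoeff_eq] at h2
  rw [hD, HahnSeries.leadingCoeff_eq, HahnSeries.leadingCoeff_eq, hD, hcoef,
    show F⁻¹.order + (F.order - 1) = -1 by omega, mul_left_comm, ← h2] at h1
  simpa using h1

/-! ### Orders of rational functions -/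

theorem expand_ne_zero (p : OnePoint ℂ) {f : RatFunc ℂ} (hf : f ≠ 0) : expand p f ≠ 0 :=
  (map_ne_zero (expand p)).mpr hf

theorem expand_algebraMap (p : OnePoint ℂ) (q : Polynomial ℂ) :
    expand p (algebraMap (Polynomial ℂ) (RatFunc ℂ) q) = Polynomial.aeval (localCoord p) q := by
  have := RatFunc.liftAlgHom_apply_div (Polynomial.aeval (R := ℂ) (localCoord p))
    (nonZeroDivisors_le_comap_nonZeroDivisors_of_injective _
      (transcendental_iff_injective.mp (transcendental_localCoord p))) q 1
  simpa [expand] using this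

theorem mem_regularFns {p : OnePoint ℂ} {f : RatFunc ℂ} :
    f ∈ regularFns p ↔ 0 ≤ (expand p f).order :=
  order_nonneg_iff.symm

theorem exists_powerSeries_expand {p : OnePoint ℂ} {f : RatFunc ℂ} (hf : f ∈ regularFns p) :
    ∃ F : PowerSeries ℂ, (F : LaurentSeries ℂ) = expand p f :=
  exists_powerSeries hf

theorem mul_mem_regularFns {p : OnePoint ℂ} {f g : RatFunc ℂ} (hf : f ∈ regularFns p)
    (hg : g ∈ regularFns p) : f * g ∈ regularFns p := by
  obtain ⟨F, hF⟩ := exists_powerSeries_expand hf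
  obtain ⟨G, hG⟩ := exists_powerSeries_expand hg
  intro n hn
  rw [map_mul, ← hF, ← hG, ← PowerSeries.coe_mul, coeff_coe_of_neg _ hn]

theorem algebraMap_mem_regularFns (p : OnePoint ℂ) (c : ℂ) :
    algebraMap ℂ (RatFunc ℂ) c ∈ regularFns p := by
  intro n hn
  rw [AlgHom.commutes, algebraMap_laurent, HahnSeries.coeff_single_of_ne hn.ne]

theorem evalFn_mul {p : OnePoint ℂ} {f g : RatFunc ℂ} (hf : f ∈ regularFns p)
    (hg : g ∈ regularFns p) : evalFn p (f * g) = evalFn p f * evalFn p g := by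
  obtain ⟨F, hF⟩ := exists_powerSeries_expand hf
  obtain ⟨G, hG⟩ := exists_powerSeries_expand hg
  change (expand p (f * g)).coeff 0 = (expand p f).coeff 0 * (expand p g).coeff 0
  rw [map_mul, ← hF, ← hG, ← PowerSeries.coe_mul, coeff_coe_zero, coeff_coe_zero, coeff_coe_zero,
    map_mul]

theorem evalFn_algebraMap (p : OnePoint ℂ) (c : ℂ) :
    evalFn p (algebraMap ℂ (RatFunc ℂ) c) = c := by
  change (expand p _).coeff 0 = c
  rw [AlgHom.commutes, algebraMap_laurent, HahnSeries.coeff_single_same]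

theorem evalFn_one (p : OnePoint ℂ) : evalFn p 1 = 1 := by
  simpa using evalFn_algebraMap p 1

/-- The linear polynomial vanishing at a point of the projective line; it is `1` for `∞`. -/
def linFactor : OnePoint ℂ → RatFunc ℂ
  | some a => algebraMap (Polynomial ℂ) (RatFunc ℂ) (Polynomial.X - Polynomial.C a)
  | none => 1

theorem linFactor_ne_zero (p : OnePoint ℂ) : linFactor p ≠ 0 := by
  cases p with
  | infty => exact one_ne_zero
  | coe a =>
    exact (map_ne_zero_iff _ (RatFunc.algebraMap_injective ℂ)).mpr (Polynomial.X_sub_C_ne_zero a)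

theorem order_of_coeff {F : LaurentSeries ℂ} {n : ℤ} (h : F.coeff n ≠ 0)
    (h' : ∀ m < n, F.coeff m = 0) : F.order = n := by
  refine le_antisymm (HahnSeries.order_le_of_coeff_ne_zero h) ?_
  exact (HahnSeries.le_order_iff_forall fun h0 => h (by simp [h0])).mpr h'

open Classical in
-- The divisor of `u - a` is `[a] - [∞]`. For `s = ∞` the constant `1` has divisor `[∞] - [∞] = 0`,
-- so one formula covers both cases.
theorem order_expand_linFactor (r s : OnePoint ℂ) :
    (expand r (linFactor s)).order =
      (if r = s then 1 else 0) - (if r = OnePoint.infty then 1 else 0) := by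
  cases s with
  | infty =>
    change (expand r 1).order = _
    simp
  | coe a =>
    change (expand r (algebraMap (Polynomial ℂ) (RatFunc ℂ) _)).order = _
    rw [expand_algebraMap, map_sub, Polynomial.aeval_X, Polynomial.aeval_C, algebraMap_laurent]
    cases r with
    | infty =>
      rw [if_neg (OnePoint.infty_ne_coe a), if_pos rfl]
      refine order_of_coeff ?_ fun m hm => ?_
      · simp [localCoord]
      · simp only [localCoord, HahnSeries.coeff_sub]
        rw [HahnSeries.coeff_single_of_ne (by omega), HahnSeries.coeff_single_of_ne (by omega),
          sub_zero]
    | coe b =>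
      rw [if_neg (OnePoint.coe_ne_infty b)]
      change (HahnSeries.single 0 b + HahnSeries.single 1 1 - HahnSeries.single 0 a :
        LaurentSeries ℂ).order = _
      by_cases hab : b = a
      · subst hab
        rw [if_pos rfl, add_sub_cancel_left, HahnSeries.order_single one_ne_zero, sub_zero]
      · rw [if_neg (fun h => hab (OnePoint.coe_injective h))]
        refine order_of_coeff ?_ fun m hm => ?_
        · simpa [sub_eq_zero] using hab
        · simp only [HahnSeries.coeff_sub, HahnSeries.coeff_add]
          rw [HahnSeries.coeff_single_of_ne (by omega), HahnSeries.coeff_single_of_ne (by omega),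
            HahnSeries.coeff_single_of_ne (by omega)]
          simp

/-- A function with a simple pole at `p`, a simple zero at `q`, and no other zeros or poles
(for `p ≠ q`). -/
def simplePole (p q : OnePoint ℂ) : RatFunc ℂ := linFactor q / linFactor p

theorem simplePole_ne_zero (p q : OnePoint ℂ) : simplePole p q ≠ 0 :=
  div_ne_zero (linFactor_ne_zero q) (linFactor_ne_zero p)

theorem simplePole_inv (p q : OnePoint ℂ) : (simplePole p q)⁻¹ = simplePole q p :=
  inv_div _ _

open Classical in
-- The contributions of the two linear factors at `∞` cancel in the quotient.
theorem order_expand_simplePole (r p q : OnePoint ℂ) :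
    (expand r (simplePole p q)).order = (if r = q then 1 else 0) - (if r = p then 1 else 0) := by
  have h : simplePole p q * linFactor p = linFactor q := div_mul_cancel₀ _ (linFactor_ne_zero p)
  have h' := congrArg (fun f => (expand r f).order) h
  simp only [map_mul] at h'
  rw [HahnSeries.order_mul (expand_ne_zero r (simplePole_ne_zero p q))
    (expand_ne_zero r (linFactor_ne_zero p)), order_expand_linFactor, order_expand_linFactor] at h'
  linarith

/-- The functions that are regular away from `p`. -/
def regularAwayFns (p : OnePoint ℂ) : Submodule ℂ (RatFunc ℂ) :=
  ⨅ q : {q : OnePoint ℂ // q ≠ p}, regularFns q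

theorem mem_regularAwayFns {p : OnePoint ℂ} {f : RatFunc ℂ} :
    f ∈ regularAwayFns p ↔ ∀ q, q ≠ p → f ∈ regularFns q := by
  simp [regularAwayFns, Submodule.mem_iInf]

theorem mul_mem_regularAwayFns {p : OnePoint ℂ} {f g : RatFunc ℂ} (hf : f ∈ regularAwayFns p)
    (hg : g ∈ regularAwayFns p) : f * g ∈ regularAwayFns p := by
  rw [mem_regularAwayFns] at *
  exact fun q hq => mul_mem_regularFns (hf q hq) (hg q hq)

theorem simplePole_mem_regularAwayFns {p q : OnePoint ℂ} :
    simplePole p q ∈ regularAwayFns p := by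
  classical
  rw [mem_regularAwayFns]
  intro r hr
  rw [mem_regularFns, order_expand_simplePole, if_neg hr]
  split_ifs <;> norm_num

theorem simplePole_pow_mem_regularAwayFns {p q : OnePoint ℂ} (n : ℕ) :
    simplePole p q ^ n ∈ regularAwayFns p := by
  induction n with
  | zero =>
    rw [pow_zero, mem_regularAwayFns]
    exact fun r _ => by simpa using algebraMap_mem_regularFns r 1
  | succ n ih =>
    rw [pow_succ]
    exact mul_mem_regularAwayFns ih simplePole_mem_regularAwayFns

theorem X_sub_C_mem_regularFns (a : ℂ) :
    algebraMap (Polynomial ℂ) (RatFunc ℂ) (Polynomial.X - Polynomial.C a) ∈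
      regularFns (a : OnePoint ℂ) := by
  classical
  rw [mem_regularFns]
  refine (order_expand_linFactor (a : OnePoint ℂ) (a : OnePoint ℂ)).symm ▸ ?_
  simp

theorem evalFn_X_sub_C (a : ℂ) :
    evalFn (a : OnePoint ℂ)
      (algebraMap (Polynomial ℂ) (RatFunc ℂ) (Polynomial.X - Polynomial.C a)) = 0 := by
  classical
  refine HahnSeries.coeff_eq_zero_of_lt_order ?_
  refine (order_expand_linFactor (a : OnePoint ℂ) (a : OnePoint ℂ)).symm ▸ ?_
  simp

theorem polynomial_mem_regularFns (a : ℂ) (f : Polynomial ℂ) :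
    algebraMap (Polynomial ℂ) (RatFunc ℂ) f ∈ regularFns (a : OnePoint ℂ) := by
  have hC (c : ℂ) : algebraMap (Polynomial ℂ) (RatFunc ℂ) (Polynomial.C c) ∈
      regularFns (a : OnePoint ℂ) := by
    have := algebraMap_mem_regularFns (a : OnePoint ℂ) c
    rwa [RatFunc.algebraMap_apply, map_one, div_one] at this
  have hX : algebraMap (Polynomial ℂ) (RatFunc ℂ) Polynomial.X ∈ regularFns (a : OnePoint ℂ) := by
    have := (regularFns (a : OnePoint ℂ)).add_mem (X_sub_C_mem_regularFns a) (hC a)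
    rwa [← map_add, sub_add_cancel] at this
  induction f using Polynomial.induction_on with
  | C c => exact hC c
  | add f g hf hg => rw [map_add]; exact Submodule.add_mem _ hf hg
  | monomial n c ih =>
    rw [pow_succ, ← mul_assoc, map_mul]
    exact mul_mem_regularFns ih hX

/-- At a root `a` of the denominator, regularity of `f` would make the numerator `f * denom` vanish
too. Evaluating a Bézout relation between numerator and denominator at `a` would then give `0 = 1`.
-/
theorem denom_eq_one_of_regular {f : RatFunc ℂ}
    (hf : ∀ a : ℂ, f ∈ regularFns (a : OnePoint ℂ)) : f.denom = 1 := by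
  refine f.monic_denom.natDegree_eq_zero.mp ?_
  by_contra hdeg
  obtain ⟨a, ha⟩ := Complex.exists_root
    (Polynomial.natDegree_pos_iff_degree_pos.mp (Nat.pos_of_ne_zero hdeg))
  obtain ⟨d, hd⟩ := Polynomial.dvd_iff_isRoot.mpr ha
  obtain ⟨u, v, huv⟩ := f.isCoprime_num_denom
  have hmul : algebraMap (Polynomial ℂ) (RatFunc ℂ) f.num =
      f * algebraMap (Polynomial ℂ) (RatFunc ℂ) f.denom :=
    (div_eq_iff ((map_ne_zero_iff _ (RatFunc.algebraMap_injective ℂ)).mpr f.denom_ne_zero)).mp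
      f.num_div_denom
  have hreg := polynomial_mem_regularFns a
  have hden : evalFn (a : OnePoint ℂ) (algebraMap (Polynomial ℂ) (RatFunc ℂ) f.denom) = 0 := by
    rw [hd, map_mul, evalFn_mul (hreg _) (hreg _), evalFn_X_sub_C, zero_mul]
  have h1 := congrArg (fun g => evalFn (a : OnePoint ℂ)
    (algebraMap (Polynomial ℂ) (RatFunc ℂ) g)) huv
  simp only [map_add, map_mul, map_one, evalFn_one] at h1
  rw [evalFn_mul (hreg _) (hreg _), evalFn_mul (hreg _) (hreg _), hmul,
    evalFn_mul (hf a) (hreg _), hden] at h1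
  simp at h1

/-- Since `u = t⁻¹` at `∞`, terms of positive degree are exactly the polar terms there; a polynomial
regular at `∞` is thus constant. -/
theorem coeff_expand_infty (f : Polynomial ℂ) (n : ℕ) :
    (expand OnePoint.infty (algebraMap (Polynomial ℂ) (RatFunc ℂ) f)).coeff (-n) = f.coeff n := by
  rw [expand_algebraMap]
  induction f using Polynomial.induction_on' with
  | add f g hf hg => simp [hf, hg]
  | monomial k c =>
    rw [Polynomial.aeval_monomial, algebraMap_laurent, HahnSeries.coeff_single_zero_mul,
      Polynomial.coeff_monomial]
    change c * ((HahnSeries.single (-1 : ℤ) (1 : ℂ)) ^ k).coeff (-n) = _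
    rw [HahnSeries.single_pow, one_pow, HahnSeries.coeff_single]
    by_cases h : k = n
    · simp [h]
    · simp [h, Ne.symm h]

/-- A rational function without poles is constant. -/
theorem eq_algebraMap_of_regular {f : RatFunc ℂ} (hf : ∀ p, f ∈ regularFns p) :
    ∃ c : ℂ, f = algebraMap ℂ (RatFunc ℂ) c := by
  have hfn : f = algebraMap (Polynomial ℂ) (RatFunc ℂ) f.num := by
    conv_lhs => rw [← f.num_div_denom, denom_eq_one_of_regular fun a => hf a, map_one, div_one]
  refine ⟨f.num.coeff 0, ?_⟩
  rw [RatFunc.algebraMap_apply, map_one, div_one]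
  conv_lhs => rw [hfn]
  congr 1
  ext n
  rw [← coeff_expand_infty, ← hfn, Polynomial.algebraMap_apply, Polynomial.coeff_C]
  split_ifs with hn
  · subst hn
    rw [← coeff_expand_infty, ← hfn]
    rfl
  · exact hf OnePoint.infty _ (by omega)

theorem eq_algebraMap_of_mem {p : OnePoint ℂ} {f : RatFunc ℂ} (h : f ∈ regularFns p)
    (h' : f ∈ regularAwayFns p) : ∃ c : ℂ, f = algebraMap ℂ (RatFunc ℂ) c := by
  refine eq_algebraMap_of_regular fun q => ?_
  by_cases hq : q = p
  · exact hq ▸ h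
  · exact mem_regularAwayFns.mp h' q hq

theorem order_expand_pow (r : OnePoint ℂ) {f : RatFunc ℂ} (hf : f ≠ 0) (n : ℕ) :
    (expand r (f ^ n)).order = n * (expand r f).order := by
  induction n with
  | zero => simp
  | succ n ih =>
    rw [pow_succ, map_mul, HahnSeries.order_mul (expand_ne_zero r (pow_ne_zero n hf))
      (expand_ne_zero r hf), ih]
    push_cast
    ring

/-- The polar part of a rational function at `p` is a polynomial in a function with a simple pole
at `p`. -/
theorem exists_sub_aeval_mem_regularFns {p q : OnePoint ℂ} (hpq : p ≠ q) (f : RatFunc ℂ) :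
    ∃ g : Polynomial ℂ, f - Polynomial.aeval (simplePole p q) g ∈ regularFns p := by
  classical
  -- Induction on a bound `N` for the pole order: a multiple of the `(N + 1)`-st power of
  -- `simplePole p q`, whose pole has order exactly `N + 1`, removes the leading polar term.
  suffices H : ∀ (N : ℕ) (f : RatFunc ℂ), (∀ n : ℤ, n < -N → (expand p f).coeff n = 0) →
      ∃ g : Polynomial ℂ, f - Polynomial.aeval (simplePole p q) g ∈ regularFns p by
    refine H (expand p f).order.natAbs f fun n hn => HahnSeries.coeff_eq_zero_of_lt_order ?_
    omega
  intro N
  induction N with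
  | zero => exact fun f hf => ⟨0, by
      rw [map_zero, sub_zero]
      exact fun n hn => hf n (by simpa using hn)⟩
  | succ N ih =>
    intro f hf
    set y := simplePole p q ^ (N + 1) with hy
    have hy0 : expand p y ≠ 0 := expand_ne_zero p (pow_ne_zero _ (simplePole_ne_zero p q))
    have hord : (expand p y).order = -(N + 1 : ℕ) := by
      rw [hy, order_expand_pow p (simplePole_ne_zero p q), order_expand_simplePole, if_neg hpq,
        if_pos rfl]
      ring
    have hlead : (expand p y).coeff (-(N + 1 : ℕ)) ≠ 0 :=
      hord ▸ mt HahnSeries.coeff_order_eq_zero.mp hy0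
    set c := (expand p f).coeff (-(N + 1 : ℕ)) / (expand p y).coeff (-(N + 1 : ℕ)) with hc
    obtain ⟨g, hg⟩ := ih (f - c • y) fun n hn => by
      rw [map_sub, HahnSeries.coeff_sub, coeff_expand_smul]
      rcases (show n = -(N + 1 : ℕ) ∨ n < -(N + 1 : ℕ) by omega) with rfl | h
      · rw [hc, div_mul_cancel₀ _ hlead, sub_self]
      · rw [hf n h, HahnSeries.coeff_eq_zero_of_lt_order (hord ▸ h), mul_zero, sub_zero]
    refine ⟨g + c • Polynomial.X ^ (N + 1), ?_⟩
    convert hg using 1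
    simp [hy]
    ring

theorem aeval_simplePole_mem (p q : OnePoint ℂ) (g : Polynomial ℂ) :
    Polynomial.aeval (simplePole p q) g ∈ regularAwayFns p := by
  rw [Polynomial.aeval_eq_sum_range]
  exact Submodule.sum_mem _ fun i _ => Submodule.smul_mem _ _ (simplePole_pow_mem_regularAwayFns i)

/-- Subtracting the polar part at `p` leaves a function with no poles at all, hence a constant. -/
theorem exists_aeval_of_mem_regularAwayFns {p q : OnePoint ℂ} (hpq : p ≠ q) {f : RatFunc ℂ}
    (hf : f ∈ regularAwayFns p) : ∃ g : Polynomial ℂ, f = Polynomial.aeval (simplePole p q) g := by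
  obtain ⟨g, hg⟩ := exists_sub_aeval_mem_regularFns hpq f
  obtain ⟨c, hc⟩ := eq_algebraMap_of_mem hg (Submodule.sub_mem _ hf (aeval_simplePole_mem p q g))
  refine ⟨g + Polynomial.C c, ?_⟩
  rw [map_add, Polynomial.aeval_C, ← hc]
  ring

theorem exists_ne_onePoint (p : OnePoint ℂ) : ∃ q : OnePoint ℂ, p ≠ q := by
  obtain ⟨q, hq⟩ := exists_ne p
  exact ⟨q, hq.symm⟩

/-- A linear choice of polar parts at `p`. -/
theorem exists_polarPart (p : OnePoint ℂ) : ∃ P : RatFunc ℂ →ₗ[ℂ] RatFunc ℂ,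
    ∀ f, P f ∈ regularAwayFns p ∧ f - P f ∈ regularFns p := by
  -- The sum of the two spaces is everything but is not direct, as both contain the constants. A
  -- linear section of the sum map makes the choice.
  obtain ⟨s, hs⟩ := LinearMap.exists_rightInverse_of_surjective
    ((regularAwayFns p).subtype.coprod (regularFns p).subtype) (by
      obtain ⟨q, hq⟩ := exists_ne_onePoint p
      refine LinearMap.range_eq_top.mpr fun f => ?_
      obtain ⟨g, hg⟩ := exists_sub_aeval_mem_regularFns hq f
      exact ⟨(⟨_, aeval_simplePole_mem p q g⟩, ⟨_, hg⟩), by simp⟩)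
  refine ⟨(regularAwayFns p).subtype ∘ₗ LinearMap.fst ℂ _ _ ∘ₗ s, fun f => ⟨(s f).1.2, ?_⟩⟩
  have h : ((s f).1 : RatFunc ℂ) + (s f).2 = f := LinearMap.congr_fun hs f
  have h' : f - (s f).1 = (s f).2 := by rw [sub_eq_iff_eq_add', h]
  exact h' ▸ (s f).2.2

/-! ### Residues -/

/-- A bilinear form `T` with `T f g = ∫ f dg` for some linear functional on differentials that
vanishes on exact ones. -/
structure IsResidueLike (T : LinearMap.BilinForm ℂ (RatFunc ℂ)) : Prop where
  leibniz : ∀ f g h, T f (g * h) = T (f * g) h + T (f * h) g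
  exact : ∀ g, T 1 g = 0

theorem isResidueLike_resForm (p : OnePoint ℂ) : IsResidueLike (resForm p) where
  leibniz f g h := by
    change (expand p f * LaurentSeries.derivative ℂ (expand p (g * h))).coeff (-1) =
      (expand p (f * g) * LaurentSeries.derivative ℂ (expand p h)).coeff (-1) +
      (expand p (f * h) * LaurentSeries.derivative ℂ (expand p g)).coeff (-1)
    rw [map_mul (expand p) g h, map_mul (expand p) f g, map_mul (expand p) f h, derivative_mul, ← HahnSeries.coeff_add]
    congr 1
    ring
  exact g := by
    change (expand p 1 * LaurentSeries.derivative ℂ (expand p g)).coeff (-1) = 0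
    rw [map_one, one_mul, coeff_derivative]
    simp

theorem IsResidueLike.add {S T : LinearMap.BilinForm ℂ (RatFunc ℂ)} (hS : IsResidueLike S)
    (hT : IsResidueLike T) : IsResidueLike (S + T) where
  leibniz f g h := by
    simp only [LinearMap.add_apply, hS.leibniz f, hT.leibniz f]
    ring
  exact g := by simp [hS.exact, hT.exact]

theorem bilin_aeval_aeval {T : LinearMap.BilinForm ℂ (RatFunc ℂ)} {v w : RatFunc ℂ} (h : ∀ m n : ℕ, T (v ^ m) (w ^ n) = 0)
    (f g : Polynomial ℂ) : T (Polynomial.aeval v f) (Polynomial.aeval w g) = 0 := by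
  simp only [Polynomial.aeval_eq_sum_range, map_sum, LinearMap.sum_apply, map_smul,
    LinearMap.smul_apply, h, smul_zero, Finset.sum_const_zero]

namespace IsResidueLike

variable {T : LinearMap.BilinForm ℂ (RatFunc ℂ)} (hT : IsResidueLike T)
include hT

theorem skew (f g : RatFunc ℂ) : T g f = -T f g := by
  have := hT.leibniz 1 f g
  rw [hT.exact, one_mul, one_mul] at this
  linear_combination -this

theorem right_one (f : RatFunc ℂ) : T f 1 = 0 := by
  rw [hT.skew, hT.exact, neg_zero]

/-- Chain rule: `d(w^(n+1)) = (n+1) w^n dw`. With `f = 1` it shows that `w^n dw` is exact in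
characteristic zero. -/
theorem pow_right (f w : RatFunc ℂ) (n : ℕ) : T f (w ^ (n + 1)) = (n + 1) * T (f * w ^ n) w := by
  induction n generalizing f with
  | zero => simp
  | succ n ih =>
    rw [pow_succ, hT.leibniz, ih, mul_assoc f w, ← pow_succ']
    push_cast
    ring

theorem pow_self (w : RatFunc ℂ) (n : ℕ) : T (w ^ n) w = 0 := by
  have := hT.pow_right 1 w n
  rw [hT.exact, one_mul] at this
  exact (mul_eq_zero.mp this.symm).resolve_left (by exact_mod_cast n.succ_ne_zero)

theorem aeval_aeval (w : RatFunc ℂ) (f g : Polynomial ℂ) :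
    T (Polynomial.aeval w f) (Polynomial.aeval w g) = 0 := by
  refine bilin_aeval_aeval (fun m n => ?_) f g
  cases n with
  | zero => rw [pow_zero, hT.right_one]
  | succ n => rw [hT.pow_right, ← pow_add, hT.pow_self, mul_zero]

theorem inv_right {y : RatFunc ℂ} (hy : y ≠ 0) (f : RatFunc ℂ) :
    T (f * y) y⁻¹ = -T (f * y⁻¹) y := by
  have := hT.leibniz f y y⁻¹
  rw [mul_inv_cancel₀ hy, hT.right_one] at this
  linear_combination -this

/-- On monomials, `y^m d(y^(-n))` is a multiple of some `y^k dy`. This is exact unless `k = -1`, and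
`h` is the assumption that disposes of `dy / y`. -/
theorem aeval_aeval_inv {y : RatFunc ℂ} (hy : y ≠ 0) (h : T y⁻¹ y = 0) (f g : Polynomial ℂ) :
    T (Polynomial.aeval y f) (Polynomial.aeval y⁻¹ g) = 0 := by
  refine bilin_aeval_aeval (fun m n => ?_) f g
  cases n with
  | zero => rw [pow_zero, hT.right_one]
  | succ n =>
    rw [hT.pow_right]
    rcases le_or_gt m n with hmn | hmn
    · obtain ⟨k, rfl⟩ := Nat.exists_eq_add_of_le hmn
      have : y ^ m * y⁻¹ ^ (m + k) = y⁻¹ ^ k := by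
        rw [pow_add, ← mul_assoc, ← mul_pow, mul_inv_cancel₀ hy, one_pow, one_mul]
      rw [this, hT.pow_self, mul_zero]
    · obtain ⟨k, rfl⟩ := Nat.exists_eq_add_of_lt hmn
      have : y ^ (n + k + 1) * y⁻¹ ^ n = y ^ k * y := by
        rw [add_assoc, pow_add, mul_right_comm, ← mul_pow, mul_inv_cancel₀ hy, one_pow, one_mul,
          pow_succ]
      rw [this, hT.inv_right hy]
      -- Up to sign the form is now `y^k y⁻¹ dy`; only `k = 0` gives the logarithmic form.
      cases k with
      | zero => rw [pow_zero, one_mul, h, neg_zero, mul_zero]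
      | succ k => rw [pow_succ, mul_assoc, mul_inv_cancel₀ hy, mul_one, hT.pow_self, neg_zero,
          mul_zero]

end IsResidueLike

theorem resForm_of_regular {p : OnePoint ℂ} {f g : RatFunc ℂ} (hf : f ∈ regularFns p)
    (hg : g ∈ regularFns p) : resForm p f g = 0 := by
  have hg' : ∀ n : ℤ, n < 0 → (LaurentSeries.derivative ℂ (expand p g)).coeff n = 0 := by
    intro n hn
    rw [coeff_derivative]
    rcases (show n = -1 ∨ n + 1 < 0 by omega) with rfl | h
    · simp
    · rw [hg _ h, mul_zero]
  obtain ⟨F, hF⟩ := exists_powerSeries_expand hf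
  obtain ⟨G, hG⟩ := exists_powerSeries hg'
  change (expand p f * LaurentSeries.derivative ℂ (expand p g)).coeff (-1) = 0
  rw [← hF, ← hG, ← PowerSeries.coe_mul, coeff_coe_of_neg _ (by norm_num)]

/-- The residue theorem for a single pole: `f` and `g` are polynomials in the same function, so `f
dg` is exact. -/
theorem resForm_of_regularAway {p : OnePoint ℂ} {f g : RatFunc ℂ} (hf : f ∈ regularAwayFns p)
    (hg : g ∈ regularAwayFns p) : resForm p f g = 0 := by
  obtain ⟨q, hq⟩ := exists_ne_onePoint p
  obtain ⟨f', rfl⟩ := exists_aeval_of_mem_regularAwayFns hq hf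
  obtain ⟨g', rfl⟩ := exists_aeval_of_mem_regularAwayFns hq hg
  exact (isResidueLike_resForm p).aeval_aeval _ f' g'

/-- The residues of `f dg` at `p` and `q` add up to zero if `f` has poles at `p` only and `g` has
poles at `q` only. -/
theorem resForm_add_resForm {p q : OnePoint ℂ} (hpq : p ≠ q) {f g : RatFunc ℂ}
    (hf : f ∈ regularAwayFns p) (hg : g ∈ regularAwayFns q) :
    resForm p f g + resForm q f g = 0 := by
  classical
  obtain ⟨f', rfl⟩ := exists_aeval_of_mem_regularAwayFns hpq hf
  obtain ⟨g', rfl⟩ := exists_aeval_of_mem_regularAwayFns hpq.symm hg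
  rw [← simplePole_inv p q]
  have hlog (r : OnePoint ℂ) (hr : (expand r (simplePole p q)).order ≠ 0) :
      resForm r (simplePole p q)⁻¹ (simplePole p q) = (expand r (simplePole p q)).order := by
    rw [← coeff_inv_mul_derivative (expand_ne_zero r (simplePole_ne_zero p q)) hr, ← map_inv₀]
    rfl
  refine ((isResidueLike_resForm p).add (isResidueLike_resForm q)).aeval_aeval_inv
    (simplePole_ne_zero p q) ?_ f' g'
  -- The logarithmic derivative has residue `-1` at the pole `p` and `1` at the zero `q`.
  rw [LinearMap.add_apply, LinearMap.add_apply, hlog, hlog] <;>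
    simp [order_expand_simplePole, hpq, hpq.symm]

end LoopCurrent
end

noncomputable section
namespace LoopCurrent

/-! ### Meromorphic maps to a Lie algebra -/

section CurrentLemmas

variable {𝔤 : Type*} [LieRing 𝔤] [LieAlgebra ℂ 𝔤]

/-- The maps with coefficients in a space `S` of rational functions. -/
def currentsIn (S : Submodule ℂ (RatFunc ℂ)) : Submodule ℂ (Current 𝔤) :=
  LinearMap.range (S.subtype.rTensor 𝔤)

theorem tmul_mem_currentsIn {S : Submodule ℂ (RatFunc ℂ)} {f : RatFunc ℂ} (hf : f ∈ S) (v : 𝔤) :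
    f ⊗ₜ v ∈ currentsIn (𝔤 := 𝔤) S :=
  ⟨⟨f, hf⟩ ⊗ₜ v, rfl⟩

theorem currentsIn_eq_span (S : Submodule ℂ (RatFunc ℂ)) :
    currentsIn (𝔤 := 𝔤) S = Submodule.span ℂ {ν | ∃ f ∈ S, ∃ v : 𝔤, ν = f ⊗ₜ v} := by
  refine le_antisymm ?_ (Submodule.span_le.mpr ?_)
  · rintro _ ⟨x, rfl⟩
    induction x with
    | zero => simp
    | add x y hx hy => rw [map_add]; exact Submodule.add_mem _ hx hy
    | tmul f v => exact Submodule.subset_span ⟨f, f.2, v, rfl⟩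
  · rintro _ ⟨f, hf, v, rfl⟩
    exact tmul_mem_currentsIn hf v

/-- Linear maps that agree on pure tensors with coefficient in `S` agree on `currentsIn S`. -/
theorem eq_of_mem_currentsIn {M : Type*} [AddCommGroup M] [Module ℂ M]
    {S : Submodule ℂ (RatFunc ℂ)} {F G : Current 𝔤 →ₗ[ℂ] M}
    (h : ∀ f ∈ S, ∀ v : 𝔤, F (f ⊗ₜ v) = G (f ⊗ₜ v)) {ν : Current 𝔤} (hν : ν ∈ currentsIn S) :
    F ν = G ν := by
  rw [currentsIn_eq_span] at hν
  refine LinearMap.eqOn_span (f := F) (g := G) ?_ hν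
  rintro _ ⟨f, hf, v, rfl⟩
  exact h f hf v

theorem mem_of_mem_currentsIn {S : Submodule ℂ (RatFunc ℂ)} {N : Submodule ℂ (Current 𝔤)}
    (h : ∀ f ∈ S, ∀ v : 𝔤, f ⊗ₜ v ∈ N) {ν : Current 𝔤} (hν : ν ∈ currentsIn S) : ν ∈ N := by
  rw [currentsIn_eq_span] at hν
  refine Submodule.span_le.mpr ?_ hν
  rintro _ ⟨f, hf, v, rfl⟩
  exact h f hf v

theorem mem_currentsIn_iff {ι : Type*} [DecidableEq ι] (b : Module.Basis ι ℂ 𝔤)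
    {S : Submodule ℂ (RatFunc ℂ)} {ν : Current 𝔤} :
    ν ∈ currentsIn S ↔ ∀ i, TensorProduct.equivFinsuppOfBasisRight b ν i ∈ S := by
  constructor
  · intro hν i
    refine mem_of_mem_currentsIn (N := S.comap (Finsupp.lapply i ∘ₗ
      (TensorProduct.equivFinsuppOfBasisRight b).toLinearMap)) (fun f hf v => ?_) hν
    simpa [TensorProduct.equivFinsuppOfBasisRight_apply_tmul_apply] using S.smul_mem _ hf
  · intro h
    rw [← (TensorProduct.equivFinsuppOfBasisRight b).symm_apply_apply ν,
      ← LinearEquiv.coe_coe, TensorProduct.equivFinsuppOfBasisRight_symm]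
    simp only [Finsupp.lsum_apply, Finsupp.sum]
    exact Submodule.sum_mem _ fun i _ => tmul_mem_currentsIn (h i) _

/-- Tensoring with `𝔤` commutes even with the infinite intersection over all `q ≠ p`, since
membership can be tested on coordinates in a basis of `𝔤`. -/
theorem regularAwayFrom_iff {p : OnePoint ℂ} {ν : Current 𝔤} :
    RegularAwayFrom p ν ↔ ν ∈ currentsIn (regularAwayFns p) := by
  classical
  have hRat (q : OnePoint ℂ) : RegularAt q ν ↔ ν ∈ currentsIn (regularFns q) := Iff.rfl
  simp only [RegularAwayFrom, hRat, mem_currentsIn_iff (Module.Basis.ofVectorSpace ℂ 𝔤),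
    mem_regularAwayFns]
  exact ⟨fun h i q hq => h q hq i, fun h q hq i => h i q hq⟩

theorem RegularAt.lie {p : OnePoint ℂ} {μ ν : Current 𝔤} (hμ : RegularAt p μ)
    (hν : RegularAt p ν) : RegularAt p ⁅μ, ν⁆ := by
  refine mem_of_mem_currentsIn (S := regularFns p) (N := (currentsIn (regularFns p)).comap
    (LieModule.toEnd ℂ (Current 𝔤) (Current 𝔤) μ)) (fun g hg w => ?_) hν
  refine mem_of_mem_currentsIn (S := regularFns p) (N := (currentsIn (regularFns p)).comap
    ((LieModule.toEnd ℂ (Current 𝔤) (Current 𝔤)).toLinearMap.flip (g ⊗ₜ w)))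
    (fun f hf v => ?_) hμ
  exact tmul_mem_currentsIn (mul_mem_regularFns hf hg) ⁅v, w⁆

theorem RegularAwayFrom.lie {p : OnePoint ℂ} {μ ν : Current 𝔤} (hμ : RegularAwayFrom p μ)
    (hν : RegularAwayFrom p ν) : RegularAwayFrom p ⁅μ, ν⁆ :=
  fun q hq => (hμ q hq).lie (hν q hq)

theorem evalAt_tmul (p : OnePoint ℂ) (f : RatFunc ℂ) (v : 𝔤) :
    evalAt p (f ⊗ₜ[ℂ] v) = evalFn p f • v := by
  simp [evalAt]

theorem evalAt_const (p : OnePoint ℂ) (v : 𝔤) : evalAt p (const 𝔤 v) = v := by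
  change evalAt p ((1 : RatFunc ℂ) ⊗ₜ[ℂ] v) = v
  rw [evalAt_tmul, evalFn_one, one_smul]

theorem evalAt_lie {p : OnePoint ℂ} {μ ν : Current 𝔤} (hμ : RegularAt p μ)
    (hν : RegularAt p ν) : evalAt p ⁅μ, ν⁆ = ⁅evalAt p μ, evalAt p ν⁆ := by
  refine eq_of_mem_currentsIn (S := regularFns p)
    (F := evalAt p ∘ₗ LieModule.toEnd ℂ (Current 𝔤) (Current 𝔤) μ)
    (G := LieModule.toEnd ℂ 𝔤 𝔤 (evalAt p μ) ∘ₗ evalAt p) (fun g hg w => ?_) hν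
  refine eq_of_mem_currentsIn (S := regularFns p)
    (F := evalAt p ∘ₗ (LieModule.toEnd ℂ (Current 𝔤) (Current 𝔤)).toLinearMap.flip (g ⊗ₜ w))
    (G := (LieModule.toEnd ℂ 𝔤 𝔤).toLinearMap.flip (evalAt p (g ⊗ₜ w)) ∘ₗ evalAt p)
    (fun f hf v => ?_) hμ
  change evalAt p ⁅f ⊗ₜ[ℂ] v, g ⊗ₜ[ℂ] w⁆ = ⁅evalAt p (f ⊗ₜ[ℂ] v), evalAt p (g ⊗ₜ[ℂ] w)⁆
  rw [LieAlgebra.ExtendScalars.bracket_tmul, evalAt_tmul, evalAt_tmul, evalAt_tmul,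
    evalFn_mul hf hg, smul_lie, lie_smul, smul_smul]

/-- No regularity of `ν` is needed: a constant map acts on the `𝔤`-coefficients only, and taking
constant terms is linear. Hence formulas written with constant terms are `𝔤`-equivariant for all
currents. -/
theorem evalAt_const_lie (p : OnePoint ℂ) (v : 𝔤) (ν : Current 𝔤) :
    evalAt p ⁅const 𝔤 v, ν⁆ = ⁅v, evalAt p ν⁆ := by
  induction ν using TensorProduct.induction_on with
  | zero => simp
  | add x y hx hy => rw [lie_add, map_add, map_add, lie_add, hx, hy]
  | tmul f w =>
    change evalAt p ⁅(1 : RatFunc ℂ) ⊗ₜ[ℂ] v, f ⊗ₜ[ℂ] w⁆ = _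
    rw [LieAlgebra.ExtendScalars.bracket_tmul, one_mul, evalAt_tmul, evalAt_tmul, lie_smul]

/-- A meromorphic map without poles is constant. -/
theorem eq_const_of_regular {p : OnePoint ℂ} {ν : Current 𝔤} (h : RegularAwayFrom p ν)
    (h' : RegularAt p ν) : ∃ v, ν = const 𝔤 v := by
  classical
  have hν : ν ∈ currentsIn (regularAwayFns p ⊓ regularFns p) := by
    rw [regularAwayFrom_iff, mem_currentsIn_iff (Module.Basis.ofVectorSpace ℂ 𝔤)] at h
    change ν ∈ currentsIn (regularFns p) at h'
    rw [mem_currentsIn_iff (Module.Basis.ofVectorSpace ℂ 𝔤)] at h' ⊢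
    exact fun i => ⟨h i, h' i⟩
  refine mem_of_mem_currentsIn (N := LinearMap.range (const 𝔤).toLinearMap) (fun f hf v => ?_) hν
    |>.imp fun _ h => h.symm
  obtain ⟨c, rfl⟩ := eq_algebraMap_of_mem hf.2 hf.1
  refine ⟨c • v, ?_⟩
  change (1 : RatFunc ℂ) ⊗ₜ[ℂ] (c • v) = _
  rw [Algebra.algebraMap_eq_smul_one, TensorProduct.smul_tmul]

/-- A linear choice of polar parts at `p`, compatible with brackets with constant maps. -/
theorem exists_polarPart_current (p : OnePoint ℂ) : ∃ P : Current 𝔤 →ₗ[ℂ] Current 𝔤,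
    (∀ ν, RegularAwayFrom p (P ν) ∧ RegularAt p (ν - P ν)) ∧
    ∀ v ν, P ⁅const 𝔤 v, ν⁆ = ⁅const 𝔤 v, P ν⁆ := by
  obtain ⟨P, hP⟩ := exists_polarPart p
  refine ⟨P.rTensor 𝔤, fun ν => ?_, fun v ν => ?_⟩
  · rw [regularAwayFrom_iff]
    induction ν using TensorProduct.induction_on with
    | zero => exact ⟨by simp, by rw [map_zero, sub_zero]; exact Submodule.zero_mem _⟩
    | add x y hx hy =>
      rw [map_add, add_sub_add_comm]
      exact ⟨Submodule.add_mem _ hx.1 hy.1, Submodule.add_mem _ hx.2 hy.2⟩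
    | tmul f v =>
      rw [LinearMap.rTensor_tmul, ← TensorProduct.sub_tmul]
      exact ⟨tmul_mem_currentsIn (hP f).1 v, tmul_mem_currentsIn (hP f).2 v⟩
  · induction ν using TensorProduct.induction_on with
    | zero => simp
    | add x y hx hy => rw [lie_add, map_add, map_add, lie_add, hx, hy]
    | tmul f w =>
      change P.rTensor 𝔤 ⁅(1 : RatFunc ℂ) ⊗ₜ[ℂ] v, f ⊗ₜ[ℂ] w⁆ =
        ⁅(1 : RatFunc ℂ) ⊗ₜ[ℂ] v, P f ⊗ₜ[ℂ] w⁆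
      rw [LieAlgebra.ExtendScalars.bracket_tmul, LieAlgebra.ExtendScalars.bracket_tmul, one_mul,
        one_mul, LinearMap.rTensor_tmul]

theorem exists_regularAway_add_regular (p : OnePoint ℂ) (ν : Current 𝔤) :
    ∃ a r, RegularAwayFrom p a ∧ RegularAt p r ∧ ν = a + r := by
  obtain ⟨P, hP, -⟩ := exists_polarPart_current (𝔤 := 𝔤) p
  exact ⟨P ν, ν - P ν, (hP ν).1, (hP ν).2, by abel⟩

/-- Splitting off the polar part at `p` leaves a map regular at `p`, which outside `p` and `q` is a
difference of regular maps. -/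
theorem exists_regularAway_add_regularAway {p q : OnePoint ℂ} {ν : Current 𝔤}
    (hν : ∀ r, r ≠ p → r ≠ q → RegularAt r ν) :
    ∃ a b, RegularAwayFrom p a ∧ RegularAwayFrom q b ∧ RegularAt p b ∧ ν = a + b := by
  obtain ⟨a, b, ha, hb, rfl⟩ := exists_regularAway_add_regular p ν
  refine ⟨a, b, ha, fun r hr => ?_, hb, rfl⟩
  by_cases hrp : r = p
  · exact hrp ▸ hb
  · have := Submodule.sub_mem _ (hν r hrp hr) (ha r hrp)
    rwa [add_sub_cancel_left] at this

/-! ### The residue pairing: vanishing, skew symmetry and cocycle identity -/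

section Residue

variable (B : LinearMap.BilinForm ℂ 𝔤)

theorem resPairing_tmul (p : OnePoint ℂ) (f g : RatFunc ℂ) (v w : 𝔤) :
    resPairing B p (f ⊗ₜ[ℂ] v) (g ⊗ₜ[ℂ] w) = resForm p f g * B v w := by
  simp [resPairing, mul_comm]

theorem bilin_eq_zero_of_currentsIn {T : LinearMap.BilinForm ℂ (Current 𝔤)}
    {R S : Submodule ℂ (RatFunc ℂ)}
    (h : ∀ f ∈ R, ∀ g ∈ S, ∀ v w : 𝔤, T (f ⊗ₜ v) (g ⊗ₜ w) = 0) {μ ν : Current 𝔤}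
    (hμ : μ ∈ currentsIn R) (hν : ν ∈ currentsIn S) : T μ ν = 0 := by
  refine eq_of_mem_currentsIn (F := T μ) (G := 0) (fun g hg w => ?_) hν
  exact eq_of_mem_currentsIn (F := T.flip (g ⊗ₜ w)) (G := 0) (fun f hf v => h f hf g hg v w) hμ

theorem resPairing_of_regular {p : OnePoint ℂ} {μ ν : Current 𝔤} (hμ : RegularAt p μ)
    (hν : RegularAt p ν) : resPairing B p μ ν = 0 :=
  bilin_eq_zero_of_currentsIn (R := regularFns p) (S := regularFns p)
    (fun f hf g hg v w => by rw [resPairing_tmul, resForm_of_regular hf hg, zero_mul]) hμ hν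

theorem resPairing_of_regularAway {p : OnePoint ℂ} {μ ν : Current 𝔤} (hμ : RegularAwayFrom p μ)
    (hν : RegularAwayFrom p ν) : resPairing B p μ ν = 0 :=
  bilin_eq_zero_of_currentsIn
    (fun f hf g hg v w => by rw [resPairing_tmul, resForm_of_regularAway hf hg, zero_mul])
    (regularAwayFrom_iff.mp hμ) (regularAwayFrom_iff.mp hν)

theorem resPairing_add_resPairing {p q : OnePoint ℂ} (hpq : p ≠ q) {μ ν : Current 𝔤}
    (hμ : RegularAwayFrom p μ) (hν : RegularAwayFrom q ν) :
    resPairing B p μ ν + resPairing B q μ ν = 0 :=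
  bilin_eq_zero_of_currentsIn (T := resPairing B p + resPairing B q)
    (fun f hf g hg v w => by
      rw [LinearMap.add_apply, LinearMap.add_apply, resPairing_tmul, resPairing_tmul, ← add_mul,
        resForm_add_resForm hpq hf hg, zero_mul])
    (regularAwayFrom_iff.mp hμ) (regularAwayFrom_iff.mp hν)

theorem resPairing_const_right (p : OnePoint ℂ) (μ : Current 𝔤) (v : 𝔤) :
    resPairing B p μ (const 𝔤 v) = 0 := by
  induction μ using TensorProduct.induction_on with
  | zero => simp
  | add x y hx hy => rw [map_add, LinearMap.add_apply, hx, hy, add_zero]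
  | tmul f w =>
    change resPairing B p _ ((1 : RatFunc ℂ) ⊗ₜ[ℂ] v) = 0
    rw [resPairing_tmul, (isResidueLike_resForm p).right_one, zero_mul]

variable {B}

theorem resPairing_skew (hB : B.IsSymm) (p : OnePoint ℂ) (μ ν : Current 𝔤) :
    resPairing B p ν μ = -resPairing B p μ ν := by
  induction μ using TensorProduct.induction_on with
  | zero => simp
  | add x y hx hy => simp only [map_add, LinearMap.add_apply, hx, hy, neg_add]
  | tmul f v =>
    induction ν using TensorProduct.induction_on with
    | zero => simp
    | add x y hx hy => simp only [map_add, LinearMap.add_apply, hx, hy, neg_add]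
    | tmul g w =>
      rw [resPairing_tmul, resPairing_tmul, (isResidueLike_resForm p).skew, hB.eq w v, neg_mul]

theorem resPairing_self (hB : B.IsSymm) (p : OnePoint ℂ) (μ : Current 𝔤) :
    resPairing B p μ μ = 0 :=
  self_eq_neg.mp (resPairing_skew hB p μ μ)

/-- On pure tensors, invariance turns all three values of `B` into `± B v ⁅w, u⁆`; what remains is
the Leibniz rule for `f d(gh)` and integration by parts. -/
theorem resPairing_cocycle (hB : B.lieInvariant 𝔤) (p : OnePoint ℂ) (μ ν α : Current 𝔤) :
    resPairing B p μ ⁅ν, α⁆ = resPairing B p ⁅μ, ν⁆ α + resPairing B p ν ⁅μ, α⁆ := by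
  induction μ using TensorProduct.induction_on with
  | zero => simp
  | add x y hx hy =>
    simp only [map_add, LinearMap.add_apply, add_lie, hx, hy]
    ring
  | tmul f v =>
    induction ν using TensorProduct.induction_on with
    | zero => simp
    | add x y hx hy =>
      simp only [map_add, LinearMap.add_apply, add_lie, lie_add, hx, hy]
      ring
    | tmul g w =>
      induction α using TensorProduct.induction_on with
      | zero => simp
      | add x y hx hy =>
        simp only [map_add, lie_add, hx, hy]
        ring
      | tmul h u =>
        simp only [LieAlgebra.ExtendScalars.bracket_tmul, resPairing_tmul]
        have h1 : B ⁅v, w⁆ u = B v ⁅w, u⁆ := by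
          rw [← lie_skew, map_neg, LinearMap.neg_apply, hB, neg_neg]
        have h2 : B w ⁅v, u⁆ = -B v ⁅w, u⁆ := by
          rw [← h1, hB, neg_neg]
        rw [h1, h2, (isResidueLike_resForm p).leibniz, (isResidueLike_resForm p).skew (f * h) g]
        ring

end Residue

end CurrentLemmas

end LoopCurrent
end

noncomputable section
namespace LoopCurrent

/-! ### Extending a representation by a cocycle -/

/-- By the universal property the generators define a map from the enveloping algebra to `S`;
followed by the inclusion it is the identity. -/
theorem universalEnvelopingAlgebra_induction {L : Type*} [LieRing L] [LieAlgebra ℂ L]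
    (S : Subalgebra ℂ (UniversalEnvelopingAlgebra ℂ L))
    (hS : ∀ x, UniversalEnvelopingAlgebra.ι ℂ x ∈ S) (a : UniversalEnvelopingAlgebra ℂ L) :
    a ∈ S := by
  let i : L →ₗ⁅ℂ⁆ S :=
    { toFun := fun x => ⟨UniversalEnvelopingAlgebra.ι ℂ x, hS x⟩
      map_add' := fun x y => Subtype.ext (map_add _ x y)
      map_smul' := fun c x => Subtype.ext (map_smul _ c x)
      map_lie' := fun {x y} => Subtype.ext (LieHom.map_lie _ x y) }
  have h : S.val.comp (UniversalEnvelopingAlgebra.lift ℂ i) = AlgHom.id ℂ _ := by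
    refine UniversalEnvelopingAlgebra.hom_ext ℂ (LieHom.ext fun x => ?_)
    change ((UniversalEnvelopingAlgebra.lift ℂ i (UniversalEnvelopingAlgebra.ι ℂ x) : S) : _) =
      UniversalEnvelopingAlgebra.ι ℂ x
    rw [UniversalEnvelopingAlgebra.lift_ι_apply]
    rfl
  have ha : ((UniversalEnvelopingAlgebra.lift ℂ i a : S) : UniversalEnvelopingAlgebra ℂ L) = a :=
    AlgHom.congr_fun h a
  exact ha ▸ (UniversalEnvelopingAlgebra.lift ℂ i a).2

/-- A linear map that intertwines two representations of `L` intertwines the actions of the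
enveloping algebra. -/
theorem universalEnvelopingAlgebra_intertwine {L M T : Type*} [LieRing L] [LieAlgebra ℂ L]
    [AddCommGroup M] [Module ℂ M] [AddCommGroup T] [Module ℂ T]
    (f : UniversalEnvelopingAlgebra ℂ L →ₐ[ℂ] Module.End ℂ M)
    (g : UniversalEnvelopingAlgebra ℂ L →ₐ[ℂ] Module.End ℂ T) (φ : T →ₗ[ℂ] M)
    (h : ∀ x t, f (UniversalEnvelopingAlgebra.ι ℂ x) (φ t) =
      φ (g (UniversalEnvelopingAlgebra.ι ℂ x) t)) (a : UniversalEnvelopingAlgebra ℂ L) (t : T) :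
    f a (φ t) = φ (g a t) := by
  let S : Subalgebra ℂ (UniversalEnvelopingAlgebra ℂ L) :=
    { carrier := {a | ∀ t, f a (φ t) = φ (g a t)}
      mul_mem' := fun {a b} ha hb t => by
        rw [map_mul f, map_mul g, Module.End.mul_apply, hb, ha, Module.End.mul_apply]
      add_mem' := fun {a b} ha hb t => by
        rw [map_add f, map_add g, LinearMap.add_apply, ha, hb, LinearMap.add_apply, map_add φ]
      algebraMap_mem' := fun c t => by
        rw [AlgHom.commutes, AlgHom.commutes, Module.algebraMap_end_apply,
          Module.algebraMap_end_apply, map_smul φ] }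
  exact universalEnvelopingAlgebra_induction S h a t

/-- The map `a ⊗ t ↦ a φ(t)` defined by an action of an algebra. -/
def actionMap {A M T : Type*} [Ring A] [Algebra ℂ A] [AddCommGroup M] [Module ℂ M]
    [AddCommGroup T] [Module ℂ T] (f : A →ₐ[ℂ] Module.End ℂ M) (φ : T →ₗ[ℂ] M) :
    A ⊗[ℂ] T →ₗ[ℂ] M :=
  TensorProduct.lift (LinearMap.lcomp ℂ M φ ∘ₗ f.toLinearMap)

theorem actionMap_tmul {A M T : Type*} [Ring A] [Algebra ℂ A] [AddCommGroup M] [Module ℂ M]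
    [AddCommGroup T] [Module ℂ T] (f : A →ₐ[ℂ] Module.End ℂ M) (φ : T →ₗ[ℂ] M) (a : A) (t : T) :
    actionMap f φ (a ⊗ₜ t) = f a (φ t) := rfl

section Cocycle

variable {L M : Type*} [LieRing L] [LieAlgebra ℂ L] [AddCommGroup M] [Module ℂ M]

/-- The representation of `L` on `M × (L → M)`, identified with the maps to `M` from the central
extension of `L` defined by the cocycle `ω`. -/
def cocycleRep (a : L →ₗ⁅ℂ⁆ Module.End ℂ M) (ω : LinearMap.BilinForm ℂ L)
    (hskew : ∀ x y, ω y x = -ω x y)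
    (hcocycle : ∀ x y z, ω x ⁅y, z⁆ = ω ⁅x, y⁆ z + ω y ⁅x, z⁆) :
    L →ₗ⁅ℂ⁆ Module.End ℂ (M × (L →ₗ[ℂ] M)) where
  toFun x :=
    { toFun := fun m => (a x m.1, a x ∘ₗ m.2 - m.2 ∘ₗ LieAlgebra.ad ℂ L x +
        (ω.flip x).smulRight m.1)
      map_add' := fun m m' => by
        refine Prod.ext (map_add _ _ _) (LinearMap.ext fun y => ?_)
        simp
        abel
      map_smul' := fun c m => by
        refine Prod.ext (map_smul _ _ _) (LinearMap.ext fun y => ?_)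
        simp [smul_sub, smul_comm c] }
  map_add' x y := by
    refine LinearMap.ext fun m => Prod.ext (by simp) (LinearMap.ext fun z => ?_)
    simp [add_smul]
    abel
  map_smul' c x := by
    refine LinearMap.ext fun m => Prod.ext (by simp) (LinearMap.ext fun z => ?_)
    simp [smul_sub, mul_smul]
  map_lie' {x y} := by
    refine LinearMap.ext fun m => Prod.ext ?_ (LinearMap.ext fun z => ?_)
    · simp [LieRing.of_associative_ring_bracket]
    -- This is the cocycle identity with `x` and `y` moved to the last slot, where `ω.flip` puts
    -- them. It makes the bracket relation hold in the second component.
    · have h : ω z ⁅x, y⁆ = ω ⁅y, z⁆ x - ω ⁅x, z⁆ y := by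
        have h1 := hcocycle z x y
        rw [← lie_skew z x, map_neg, LinearMap.neg_apply, hskew ⁅z, y⁆ x, ← lie_skew z y, map_neg,
          LinearMap.neg_apply, neg_neg] at h1
        rw [h1]
        ring
      simp [LieRing.of_associative_ring_bracket, h, sub_smul]
      abel

theorem cocycleRep_apply (a : L →ₗ⁅ℂ⁆ Module.End ℂ M) (ω : LinearMap.BilinForm ℂ L)
    (hskew : ∀ x y, ω y x = -ω x y)
    (hcocycle : ∀ x y z, ω x ⁅y, z⁆ = ω ⁅x, y⁆ z + ω y ⁅x, z⁆) (x : L) (m : M × (L →ₗ[ℂ] M)) :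
    cocycleRep a ω hskew hcocycle x m = (a x m.1, a x ∘ₗ m.2 - m.2 ∘ₗ LieAlgebra.ad ℂ L x +
        (ω.flip x).smulRight m.1) := rfl

end Cocycle

/-! ### The induced module -/

section InducedLemmas

variable {𝔤 : Type*} [LieRing 𝔤] [LieAlgebra ℂ 𝔤] {n : ℕ}
  (W : Fin n → Type*) [∀ j, AddCommGroup (W j)] [∀ j, Module ℂ (W j)]
  [∀ j, LieRingModule 𝔤 (W j)] [∀ j, LieModule ℂ 𝔤 (W j)]

theorem leftMul_mk (a b : UniversalEnvelopingAlgebra ℂ (Current 𝔤)) (t : ⨂[ℂ] i, W i) :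
    leftMul 𝔤 W a ((balancing 𝔤 W).mkQ (b ⊗ₜ t)) = (balancing 𝔤 W).mkQ ((a * b) ⊗ₜ t) := rfl

theorem leftMul_vac (a : UniversalEnvelopingAlgebra ℂ (Current 𝔤)) (t : ⨂[ℂ] i, W i) :
    leftMul 𝔤 W a (vac 𝔤 W t) = (balancing 𝔤 W).mkQ (a ⊗ₜ t) := by
  change (balancing 𝔤 W).mkQ ((a * 1) ⊗ₜ t) = _
  rw [mul_one]

theorem induced_ext {M : Type*} [AddCommGroup M] [Module ℂ M]
    {F G : InducedModule 𝔤 W →ₗ[ℂ] M}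
    (h : ∀ a t, F ((balancing 𝔤 W).mkQ (a ⊗ₜ t)) = G ((balancing 𝔤 W).mkQ (a ⊗ₜ t))) : F = G :=
  Submodule.linearMap_qext _ (TensorProduct.ext' h)

theorem leftMul_add (a b : UniversalEnvelopingAlgebra ℂ (Current 𝔤)) :
    leftMul 𝔤 W (a + b) = leftMul 𝔤 W a + leftMul 𝔤 W b :=
  induced_ext W fun c t => by
    simp only [LinearMap.add_apply, leftMul_mk, add_mul, TensorProduct.add_tmul, map_add]

theorem leftMul_smul (c : ℂ) (a : UniversalEnvelopingAlgebra ℂ (Current 𝔤)) :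
    leftMul 𝔤 W (c • a) = c • leftMul 𝔤 W a :=
  induced_ext W fun b t => by
    simp only [LinearMap.smul_apply, leftMul_mk, smul_mul_assoc, ← TensorProduct.smul_tmul',
      map_smul]

theorem leftMul_one : leftMul 𝔤 W 1 = 1 :=
  induced_ext W fun c t => by
    rw [leftMul_mk, one_mul]; rfl

theorem leftMul_mul (a b : UniversalEnvelopingAlgebra ℂ (Current 𝔤)) :
    leftMul 𝔤 W (a * b) = leftMul 𝔤 W a * leftMul 𝔤 W b :=
  induced_ext W fun c t => by
    rw [Module.End.mul_apply, leftMul_mk, leftMul_mk, leftMul_mk, mul_assoc]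

variable (𝔤) in
/-- The action of the enveloping algebra on the induced module. -/
def leftMulHom : UniversalEnvelopingAlgebra ℂ (Current 𝔤) →ₐ[ℂ]
    Module.End ℂ (InducedModule 𝔤 W) :=
  AlgHom.ofLinearMap
    { toFun := leftMul 𝔤 W
      map_add' := leftMul_add W
      map_smul' := leftMul_smul W }
    (leftMul_one W) (leftMul_mul W)

/-- The action of meromorphic maps on the induced module. -/
def currentAct : Current 𝔤 →ₗ⁅ℂ⁆ Module.End ℂ (InducedModule 𝔤 W) where
  toFun α := leftMul 𝔤 W (UniversalEnvelopingAlgebra.ι ℂ α)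
  map_add' α β := by rw [map_add, leftMul_add]
  map_smul' c α := by rw [map_smul, leftMul_smul, RingHom.id_apply]
  map_lie' {α β} := by
    simp only [LieHom.map_lie, LieRing.of_associative_ring_bracket]
    rw [← leftMul_mul, ← leftMul_mul, sub_eq_add_neg, sub_eq_add_neg, leftMul_add,
      ← neg_one_smul ℂ (_ * _), leftMul_smul, neg_one_smul ℂ (leftMul 𝔤 W _)]

theorem currentAct_apply (α : Current 𝔤) :
    currentAct W α = leftMul 𝔤 W (UniversalEnvelopingAlgebra.ι ℂ α) := rfl

theorem currentAct_lie (α β : Current 𝔤) (x : InducedModule 𝔤 W) :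
    currentAct W ⁅α, β⁆ x =
      currentAct W α (currentAct W β x) - currentAct W β (currentAct W α x) := by
  rw [LieHom.map_lie, LieRing.of_associative_ring_bracket]
  rfl

theorem currentAct_const_vac (v : 𝔤) (t : ⨂[ℂ] i, W i) :
    currentAct W (const 𝔤 v) (vac 𝔤 W t) = vac 𝔤 W (diag W v t) := by
  rw [currentAct_apply, leftMul_vac]
  refine (Submodule.Quotient.eq _).mpr (Submodule.subset_span
    ⟨1, UniversalEnvelopingAlgebra.ι ℂ v, t, ?_⟩)
  rw [constU, UniversalEnvelopingAlgebra.lift_ι_apply, UniversalEnvelopingAlgebra.lift_ι_apply,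
    one_mul]
  rfl

theorem diag_apply (v : 𝔤) (t : ⨂[ℂ] i, W i) : diag W v t = ∑ j, actAt W j v t := by
  change (∑ j, actAt W j) v t = _
  simp

/-- The induced module is generated by the elements `1 ⊗ t`. -/
theorem mem_of_forall_vac {N : Submodule ℂ (InducedModule 𝔤 W)} (hvac : ∀ t, vac 𝔤 W t ∈ N)
    (hact : ∀ α : Current 𝔤, ∀ x ∈ N, currentAct W α x ∈ N) (x : InducedModule 𝔤 W) : x ∈ N := by
  let S : Subalgebra ℂ (UniversalEnvelopingAlgebra ℂ (Current 𝔤)) :=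
    { carrier := {a | ∀ x ∈ N, leftMul 𝔤 W a x ∈ N}
      mul_mem' := fun {a b} ha hb x hx => by
        rw [leftMul_mul]
        exact ha _ (hb _ hx)
      add_mem' := fun {a b} ha hb x hx => by
        rw [leftMul_add]
        exact N.add_mem (ha _ hx) (hb _ hx)
      algebraMap_mem' := fun c x hx => by
        rw [Algebra.algebraMap_eq_smul_one, leftMul_smul, leftMul_one]
        exact N.smul_mem c hx }
  obtain ⟨y, rfl⟩ := (balancing 𝔤 W).mkQ_surjective x
  induction y using TensorProduct.induction_on with
  | zero => simp
  | add y y' hy hy' => rw [map_add]; exact N.add_mem hy hy'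
  | tmul a t =>
    rw [← leftMul_vac]
    exact universalEnvelopingAlgebra_induction S hact a _ (hvac t)

set_option maxHeartbeats 1000000 in
/-- Operators with a prescribed cocycle commutator with the currents exist as soon as the
prescribed values on `1 ⊗ t` are compatible with constant maps. -/
theorem exists_extension {ω : LinearMap.BilinForm ℂ (Current 𝔤)}
    (hskew : ∀ x y, ω y x = -ω x y)
    (hcocycle : ∀ x y z, ω x ⁅y, z⁆ = ω ⁅x, y⁆ z + ω y ⁅x, z⁆)
    (hconst : ∀ x v, ω x (const 𝔤 v) = 0)
    (J₀ : Current 𝔤 →ₗ[ℂ] (⨂[ℂ] i, W i) →ₗ[ℂ] InducedModule 𝔤 W)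
    (hJ₀ : ∀ v ν t, J₀ ν (diag W v t) =
      currentAct W (const 𝔤 v) (J₀ ν t) - J₀ ⁅const 𝔤 v, ν⁆ t) :
    ∃ J : Current 𝔤 →ₗ[ℂ] Module.End ℂ (InducedModule 𝔤 W),
      (∀ ν α x, J ν (currentAct W α x) =
        currentAct W α (J ν x) + J ⁅ν, α⁆ x + ω ν α • x) ∧
      ∀ ν t, J ν (vac 𝔤 W t) = J₀ ν t := by
  obtain ⟨ρ, hρ⟩ : ∃ ρ, ρ = UniversalEnvelopingAlgebra.lift ℂ
    (cocycleRep (currentAct W) ω hskew hcocycle) := ⟨_, rfl⟩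
  have hρι (α : Current 𝔤) : ρ (UniversalEnvelopingAlgebra.ι ℂ α) =
      cocycleRep (currentAct W) ω hskew hcocycle α := by
    rw [hρ, UniversalEnvelopingAlgebra.lift_ι_apply]
  -- The pair `(x, ν ↦ J^ν x)` is prescribed for `x = 1 ⊗ t`. By `hJ₀` and `hconst` this map is
  -- `𝔤`-equivariant, so it respects the balancing relations and extends to the induced module as
  -- `Φ`.
  set Φ₀ := (vac 𝔤 W).prod J₀.flip with hΦ₀
  have hfst (a m) : (ρ a m).1 = leftMul 𝔤 W a m.1 :=
    (universalEnvelopingAlgebra_intertwine (leftMulHom 𝔤 W) ρ (LinearMap.fst ℂ _ _)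
      (fun x m => by rw [hρι]; rfl) a m).symm
  have hdiag (b t) : ρ (constU 𝔤 b) (Φ₀ t) =
      Φ₀ (UniversalEnvelopingAlgebra.lift ℂ (diag W) b t) := by
    refine universalEnvelopingAlgebra_intertwine (ρ.comp (constU 𝔤)) _ Φ₀ (fun v t => ?_) b t
    rw [AlgHom.comp_apply, constU, UniversalEnvelopingAlgebra.lift_ι_apply,
      UniversalEnvelopingAlgebra.lift_ι_apply]
    change ρ (UniversalEnvelopingAlgebra.ι ℂ (const 𝔤 v)) _ = _
    rw [hρι, cocycleRep_apply]
    refine Prod.ext (currentAct_const_vac W v t) (LinearMap.ext fun ν => ?_)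
    simp [hΦ₀, hconst, hJ₀]
  have hker : balancing 𝔤 W ≤ LinearMap.ker (actionMap ρ Φ₀) := by
    refine Submodule.span_le.mpr ?_
    rintro _ ⟨a, b, t, rfl⟩
    refine LinearMap.mem_ker.mpr ?_
    rw [map_sub, actionMap_tmul, actionMap_tmul, map_mul ρ, Module.End.mul_apply, hdiag, sub_self]
  obtain ⟨Φ, hΦ⟩ : ∃ Φ : InducedModule 𝔤 W →ₗ[ℂ]
      InducedModule 𝔤 W × (Current 𝔤 →ₗ[ℂ] InducedModule 𝔤 W),
      ∀ a t, Φ ((balancing 𝔤 W).mkQ (a ⊗ₜ t)) = ρ a (Φ₀ t) :=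
    ⟨(balancing 𝔤 W).liftQ (actionMap ρ Φ₀) hker, fun a t => rfl⟩
  -- With the first component equal to the identity, equivariance of `Φ` in the second component is
  -- exactly the required commutator relation.
  have hΦfst (x) : (Φ x).1 = x := by
    have : LinearMap.fst ℂ _ _ ∘ₗ Φ = LinearMap.id := induced_ext W fun a t => by
      change (Φ ((balancing 𝔤 W).mkQ (a ⊗ₜ t))).1 = (balancing 𝔤 W).mkQ (a ⊗ₜ t)
      rw [hΦ, hfst, ← leftMul_vac]
      rfl
    exact LinearMap.congr_fun this x
  have hΦact (α x) : Φ (currentAct W α x) =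
      cocycleRep (currentAct W) ω hskew hcocycle α (Φ x) := by
    have : Φ ∘ₗ currentAct W α = cocycleRep (currentAct W) ω hskew hcocycle α ∘ₗ Φ :=
      induced_ext W fun a t => by
        change Φ ((balancing 𝔤 W).mkQ ((UniversalEnvelopingAlgebra.ι ℂ α * a) ⊗ₜ t)) =
          cocycleRep (currentAct W) ω hskew hcocycle α (Φ ((balancing 𝔤 W).mkQ (a ⊗ₜ t)))
        rw [hΦ, hΦ, map_mul ρ, Module.End.mul_apply, hρι]
    exact LinearMap.congr_fun this x
  refine ⟨(LinearMap.snd ℂ _ _ ∘ₗ Φ).flip, fun ν α x => ?_, fun ν t => ?_⟩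
  · change (Φ (currentAct W α x)).2 ν = currentAct W α ((Φ x).2 ν) + (Φ x).2 ⁅ν, α⁆ + ω ν α • x
    rw [hΦact, cocycleRep_apply, hΦfst, ← lie_skew ν α, map_neg]
    simp [sub_eq_add_neg]
  · change (Φ ((balancing 𝔤 W).mkQ (1 ⊗ₜ t))).2 ν = J₀ ν t
    rw [hΦ, map_one]
    rfl

end InducedLemmas

end LoopCurrent
end

noncomputable section
namespace LoopCurrent

/-! ### Construction of the loop operators from their values on `1 ⊗ t` -/

section LoopOperators

variable {𝔤 : Type*} [LieRing 𝔤] [LieAlgebra ℂ 𝔤] {n : ℕ}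
  (W : Fin n → Type*) [∀ j, AddCommGroup (W j)] [∀ j, Module ℂ (W j)]
  [∀ j, LieRingModule 𝔤 (W j)] [∀ j, LieModule ℂ 𝔤 (W j)]

/-- The action of `v : Fin n → 𝔤` on the tensor factors with index in `S`. -/
def partialAct (S : Finset (Fin n)) : (Fin n → 𝔤) →ₗ[ℂ] Module.End ℂ (⨂[ℂ] i, W i) :=
  ∑ j ∈ S, actAt W j ∘ₗ LinearMap.proj j

theorem partialAct_apply (S : Finset (Fin n)) (v : Fin n → 𝔤) :
    partialAct W S v = ∑ j ∈ S, actAt W j (v j) := by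
  simp [partialAct]

theorem partialAct_congr {S : Finset (Fin n)} {v v' : Fin n → 𝔤} (h : ∀ i ∈ S, v i = v' i) :
    partialAct W S v = partialAct W S v' := by
  rw [partialAct_apply, partialAct_apply]
  exact Finset.sum_congr rfl fun i hi => by rw [h i hi]

/-- Actions on different factors commute, so only common indices contribute. -/
theorem partialAct_lie (S S' : Finset (Fin n)) (v v' : Fin n → 𝔤) :
    ⁅partialAct W S v, partialAct W S' v'⁆ = partialAct W (S ∩ S') fun i => ⁅v i, v' i⁆ := by
  simp only [partialAct_apply, LieRing.of_associative_ring_bracket, Finset.sum_mul_sum]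
  rw [Finset.sum_comm (s := S'), ← Finset.sum_sub_distrib, ← Finset.sum_ite_mem]
  refine Finset.sum_congr rfl fun i _ => ?_
  rw [← Finset.sum_sub_distrib, Finset.sum_congr rfl fun j _ =>
    (LieRing.of_associative_ring_bracket _ _).symm.trans (actAt_lie W i j (v i) (v' j))]
  simp

theorem partialAct_comm (S S' : Finset (Fin n)) (v v' : Fin n → 𝔤) (t : ⨂[ℂ] i, W i) :
    partialAct W S v (partialAct W S' v' t) = partialAct W S' v' (partialAct W S v t) +
      partialAct W (S ∩ S') (fun i => ⁅v i, v' i⁆) t := by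
  rw [← partialAct_lie, LieRing.of_associative_ring_bracket, LinearMap.sub_apply,
    Module.End.mul_apply, Module.End.mul_apply, add_sub_cancel]

theorem diag_eq_partialAct (v : 𝔤) : diag W v = partialAct W Finset.univ fun _ => v := by
  ext t
  simp [diag_apply, partialAct_apply]

theorem partialAct_singleton_add {l m : Fin n} (hlm : l ≠ m) (v : Fin n → 𝔤) :
    partialAct W {m} v + partialAct W (Finset.univ.erase l ∩ Finset.univ.erase m) v =
      partialAct W (Finset.univ.erase l) v := by
  rw [partialAct_apply, partialAct_apply, partialAct_apply, Finset.sum_singleton,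
    ← Finset.add_sum_erase _ _ (Finset.mem_erase.mpr ⟨hlm.symm, Finset.mem_univ m⟩),
    Finset.inter_erase, Finset.inter_univ]

variable (z : Fin n → OnePoint ℂ)

/-- The constant terms of a meromorphic map at the insertion points. -/
def evalAll : Current 𝔤 →ₗ[ℂ] (Fin n → 𝔤) := LinearMap.pi fun i => evalAt (z i)

theorem evalAll_apply (ν : Current 𝔤) (i : Fin n) : evalAll z ν i = evalAt (z i) ν := rfl

/-- The value `ν ⊗ t - ∑_{j ≠ l} 1 ⊗ ν(z j)^{(j)} t` that is prescribed for `ν` regular away from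
`z l`. -/
def awayMap (l : Fin n) : Current 𝔤 →ₗ[ℂ] (⨂[ℂ] i, W i) →ₗ[ℂ] InducedModule 𝔤 W :=
  LinearMap.mk₂ ℂ
    (fun ν t => currentAct W ν (vac 𝔤 W t) -
      vac 𝔤 W (partialAct W (Finset.univ.erase l) (evalAll z ν) t))
    (fun ν ν' t => by simp only [map_add, LinearMap.add_apply]; abel)
    (fun c ν t => by simp only [map_smul, LinearMap.smul_apply, smul_sub])
    (fun ν t t' => by simp only [map_add]; abel)
    (fun c ν t => by simp only [map_smul, smul_sub])

theorem awayMap_apply (l : Fin n) (ν : Current 𝔤) (t : ⨂[ℂ] i, W i) :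
    awayMap W z l ν t = currentAct W ν (vac 𝔤 W t) -
      vac 𝔤 W (partialAct W (Finset.univ.erase l) (evalAll z ν) t) := rfl

/-- The value `1 ⊗ ν(z l)^{(l)} t` that is prescribed for `ν` regular at `z l`. -/
def regularMap (l : Fin n) : Current 𝔤 →ₗ[ℂ] (⨂[ℂ] i, W i) →ₗ[ℂ] InducedModule 𝔤 W :=
  LinearMap.mk₂ ℂ (fun ν t => vac 𝔤 W (partialAct W {l} (evalAll z ν) t))
    (fun ν ν' t => by simp only [map_add, LinearMap.add_apply])
    (fun c ν t => by simp only [map_smul, LinearMap.smul_apply])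
    (fun ν t t' => by simp only [map_add])
    (fun c ν t => by simp only [map_smul])

theorem regularMap_apply (l : Fin n) (ν : Current 𝔤) (t : ⨂[ℂ] i, W i) :
    regularMap W z l ν t = vac 𝔤 W (partialAct W {l} (evalAll z ν) t) := rfl

/-- Moving the diagonal action past the partial one produces `⁅v, ν(z j)⁆`, the constant term of
`⁅v, ν⁆` at `z j`. This is the compatibility with constants that `exists_extension` requires. -/
theorem vac_partialAct_diag (S : Finset (Fin n)) (ν : Current 𝔤) (v : 𝔤) (t : ⨂[ℂ] i, W i) :
    vac 𝔤 W (partialAct W S (evalAll z ν) (diag W v t)) =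
      currentAct W (const 𝔤 v) (vac 𝔤 W (partialAct W S (evalAll z ν) t)) -
        vac 𝔤 W (partialAct W S (evalAll z ⁅const 𝔤 v, ν⁆) t) := by
  rw [currentAct_const_vac, diag_eq_partialAct, partialAct_comm W Finset.univ S, Finset.univ_inter,
    map_add, partialAct_congr W (v := evalAll z ⁅const 𝔤 v, ν⁆) fun i _ =>
      evalAt_const_lie (z i) v ν]
  exact (add_sub_cancel_right _ _).symm

theorem awayMap_diag (l : Fin n) (v : 𝔤) (ν : Current 𝔤) (t : ⨂[ℂ] i, W i) :
    awayMap W z l ν (diag W v t) =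
      currentAct W (const 𝔤 v) (awayMap W z l ν t) - awayMap W z l ⁅const 𝔤 v, ν⁆ t := by
  rw [awayMap_apply, awayMap_apply, awayMap_apply, vac_partialAct_diag, currentAct_lie,
    ← currentAct_const_vac, map_sub]
  abel

theorem regularMap_diag (l : Fin n) (v : 𝔤) (ν : Current 𝔤) (t : ⨂[ℂ] i, W i) :
    regularMap W z l ν (diag W v t) =
      currentAct W (const 𝔤 v) (regularMap W z l ν t) - regularMap W z l ⁅const 𝔤 v, ν⁆ t :=
  vac_partialAct_diag W z {l} ν v t

/-- The balancing relation turns `v ⊗ t` into the sum of the actions on all factors; removing those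
with `j ≠ l` leaves the `l`-th. -/
theorem awayMap_const (l : Fin n) (v : 𝔤) (t : ⨂[ℂ] i, W i) :
    awayMap W z l (const 𝔤 v) t = regularMap W z l (const 𝔤 v) t := by
  rw [awayMap_apply, regularMap_apply, currentAct_const_vac, diag_apply, sub_eq_iff_eq_add,
    ← map_add, partialAct_apply, partialAct_apply, Finset.sum_singleton, LinearMap.sum_apply,
    ← Finset.add_sum_erase _ _ (Finset.mem_univ l)]
  simp only [evalAll_apply, evalAt_const]

variable {W z}

theorem vac_partialAct_univ_erase (l : Fin n) (ν : Current 𝔤) (t : ⨂[ℂ] i, W i) :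
    vac 𝔤 W (partialAct W (Finset.univ.erase l) (evalAll z ν) t) =
      ∑ j ∈ Finset.univ.erase l, vac 𝔤 W (actAt W j (evalAt (z j) ν) t) := by
  rw [partialAct_apply, LinearMap.sum_apply, map_sum]
  rfl

theorem exists_isLoopOperator {B : LinearMap.BilinForm ℂ 𝔤} (hBsymm : B.IsSymm)
    (hBinv : B.lieInvariant 𝔤) (l : Fin n) :
    ∃ J : Current 𝔤 →ₗ[ℂ] Module.End ℂ (InducedModule 𝔤 W), IsLoopOperator W B z l J := by
  obtain ⟨P, hP, hPconst⟩ := exists_polarPart_current (𝔤 := 𝔤) (z l)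
  obtain ⟨J, hJ, hJ₀⟩ : ∃ J : Current 𝔤 →ₗ[ℂ] Module.End ℂ (InducedModule 𝔤 W),
      (∀ ν α x, J ν (currentAct W α x) =
        currentAct W α (J ν x) + J ⁅ν, α⁆ x + resPairing B (z l) ν α • x) ∧
      ∀ ν t, J ν (vac 𝔤 W t) = awayMap W z l (P ν) t + regularMap W z l (ν - P ν) t := by
    refine exists_extension W (resPairing_skew hBsymm (z l))
      (resPairing_cocycle hBinv (z l)) (resPairing_const_right B (z l))
      (awayMap W z l ∘ₗ P + regularMap W z l ∘ₗ (LinearMap.id - P)) fun v ν t => ?_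
    simp only [LinearMap.add_apply, LinearMap.comp_apply, LinearMap.sub_apply,
      LinearMap.id_apply, hPconst, awayMap_diag, regularMap_diag, ← lie_sub,
      map_add (currentAct W _)]
    abel
  have hagree (ν : Current 𝔤) (h : RegularAwayFrom (z l) ν) (h' : RegularAt (z l) ν) :
      awayMap W z l ν = regularMap W z l ν := by
    obtain ⟨v, rfl⟩ := eq_const_of_regular h h'
    exact LinearMap.ext (awayMap_const W z l v)
  refine ⟨J, fun ν α => LinearMap.ext fun x => ?_, fun ν hν w => ?_, fun ν hν w => ?_⟩
  · rw [LieRing.of_associative_ring_bracket]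
    change J ν (currentAct W α x) - currentAct W α (J ν x) =
      resPairing B (z l) ν α • x + J ⁅ν, α⁆ x
    rw [hJ]
    abel
  -- Here `ν - P ν` has no poles, so it is constant and the two prescriptions agree on it. The
  -- choice of polar parts therefore does not affect the value; the next case is symmetric.
  · have haway : RegularAwayFrom (z l) (ν - P ν) := by
      rw [regularAwayFrom_iff] at hν ⊢
      exact Submodule.sub_mem _ hν (regularAwayFrom_iff.mp (hP ν).1)
    rw [hJ₀, ← hagree _ haway (hP ν).2, ← LinearMap.add_apply, ← map_add, add_sub_cancel,
      awayMap_apply, vac_partialAct_univ_erase]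
    rfl
  · have hreg : RegularAt (z l) (P ν) := by
      have := Submodule.sub_mem _ hν (hP ν).2
      rwa [sub_sub_cancel] at this
    rw [hJ₀, hagree _ (hP ν).1 hreg, ← LinearMap.add_apply, ← map_add, add_sub_cancel,
      regularMap_apply, partialAct_apply, Finset.sum_singleton]
    rfl

/-! ### Uniqueness and commutation relations -/

namespace IsLoopOperator

variable {B : LinearMap.BilinForm ℂ 𝔤} {l m : Fin n}
  {J : Current 𝔤 →ₗ[ℂ] Module.End ℂ (InducedModule 𝔤 W)}

theorem apply_currentAct (hJ : IsLoopOperator W B z l J) (ν α : Current 𝔤)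
    (x : InducedModule 𝔤 W) : J ν (currentAct W α x) =
      currentAct W α (J ν x) + J ⁅ν, α⁆ x + resPairing B (z l) ν α • x := by
  have h := LinearMap.congr_fun (hJ.commutator ν α) x
  rw [LieRing.of_associative_ring_bracket] at h
  change J ν (currentAct W α x) - currentAct W α (J ν x) =
    resPairing B (z l) ν α • x + J ⁅ν, α⁆ x at h
  rw [sub_eq_iff_eq_add] at h
  rw [h]
  abel

theorem vac_of_regularAway (hJ : IsLoopOperator W B z l J) {ν : Current 𝔤}
    (hν : RegularAwayFrom (z l) ν) (t : ⨂[ℂ] i, W i) : J ν (vac 𝔤 W t) =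
      currentAct W ν (vac 𝔤 W t) -
        vac 𝔤 W (partialAct W (Finset.univ.erase l) (evalAll z ν) t) := by
  have : J ν ∘ₗ vac 𝔤 W = awayMap W z l ν :=
    PiTensorProduct.ext (MultilinearMap.ext fun w => by
      change J ν (vac 𝔤 W _) = awayMap W z l ν _
      rw [hJ.regular_away ν hν w, awayMap_apply, vac_partialAct_univ_erase]
      rfl)
  exact LinearMap.congr_fun this t

theorem vac_of_regular (hJ : IsLoopOperator W B z l J) {ν : Current 𝔤}
    (hν : RegularAt (z l) ν) (t : ⨂[ℂ] i, W i) :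
    J ν (vac 𝔤 W t) = vac 𝔤 W (partialAct W {l} (evalAll z ν) t) := by
  have : J ν ∘ₗ vac 𝔤 W = regularMap W z l ν :=
    PiTensorProduct.ext (MultilinearMap.ext fun w => by
      change J ν (vac 𝔤 W _) = regularMap W z l ν _
      rw [hJ.regular_at ν hν w, regularMap_apply, partialAct_apply, Finset.sum_singleton]
      rfl)
  exact LinearMap.congr_fun this t

theorem unique {J' : Current 𝔤 →ₗ[ℂ] Module.End ℂ (InducedModule 𝔤 W)}
    (hJ : IsLoopOperator W B z l J) (hJ' : IsLoopOperator W B z l J') : J' = J := by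
  -- Agreement is required for all `ν` at once, because commuting with `α` introduces `J^⁅ν, α⁆`.
  let N : Submodule ℂ (InducedModule 𝔤 W) := LinearMap.ker (J' - J).flip
  have hN (x) : x ∈ N ↔ ∀ ν, J' ν x = J ν x := by
    simp only [N, LinearMap.mem_ker, LinearMap.ext_iff, LinearMap.flip_apply, LinearMap.sub_apply,
      LinearMap.zero_apply, sub_eq_zero]
  refine LinearMap.ext fun ν => LinearMap.ext fun x => ?_
  refine (hN x).mp (mem_of_forall_vac W (fun t => ?_) (fun α x hx => ?_) x) ν
  · rw [hN]
    intro ν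
    obtain ⟨a, r, ha, hr, rfl⟩ := exists_regularAway_add_regular (z l) ν
    rw [map_add, map_add, LinearMap.add_apply, LinearMap.add_apply, hJ.vac_of_regularAway ha,
      hJ.vac_of_regular hr, hJ'.vac_of_regularAway ha, hJ'.vac_of_regular hr]
  · rw [hN] at hx ⊢
    intro ν
    rw [hJ.apply_currentAct, hJ'.apply_currentAct, hx, hx]

theorem evalAll_lie {S : Finset (Fin n)} {μ ν : Current 𝔤} (hμ : ∀ i ∈ S, RegularAt (z i) μ)
    (hν : ∀ i ∈ S, RegularAt (z i) ν) :
    partialAct W S (fun i => ⁅evalAll z μ i, evalAll z ν i⁆) =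
      partialAct W S (evalAll z ⁅μ, ν⁆) :=
  partialAct_congr W fun i hi => (evalAt_lie (hμ i hi) (hν i hi)).symm

theorem partialAct_evalAll_comm {S S' : Finset (Fin n)} {μ ν : Current 𝔤}
    (hμ : ∀ i ∈ S ∩ S', RegularAt (z i) μ) (hν : ∀ i ∈ S ∩ S', RegularAt (z i) ν)
    (t : ⨂[ℂ] i, W i) :
    partialAct W S (evalAll z μ) (partialAct W S' (evalAll z ν) t) =
      partialAct W S' (evalAll z ν) (partialAct W S (evalAll z μ) t) +
        partialAct W (S ∩ S') (evalAll z ⁅μ, ν⁆) t := by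
  rw [partialAct_comm, evalAll_lie hμ hν]

theorem _root_.LoopCurrent.RegularAwayFrom.regularAt_erase (hz : Function.Injective z)
    {ν : Current 𝔤} (hν : RegularAwayFrom (z l) ν) {i : Fin n} (hi : i ∈ Finset.univ.erase l) :
    RegularAt (z i) ν :=
  hν _ fun h => (Finset.mem_erase.mp hi).1 (hz h)

theorem commute_vac_of_regular (hlm : l ≠ m)
    {J' : Current 𝔤 →ₗ[ℂ] Module.End ℂ (InducedModule 𝔤 W)}
    (hJ : IsLoopOperator W B z l J) (hJ' : IsLoopOperator W B z m J') {r s : Current 𝔤}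
    (hr : RegularAt (z l) r) (hs : RegularAt (z m) s) (t : ⨂[ℂ] i, W i) :
    J r (J' s (vac 𝔤 W t)) = J' s (J r (vac 𝔤 W t)) := by
  have hint : ({l} : Finset (Fin n)) ∩ {m} = ∅ := Finset.singleton_inter_of_notMem (by simpa)
  have h0 := partialAct_evalAll_comm (W := W) (z := z) (S := {l}) (S' := {m}) (μ := r) (ν := s)
    (by simp [hint]) (by simp [hint]) t
  rw [hint, partialAct_apply W ∅, Finset.sum_empty, LinearMap.zero_apply, add_zero] at h0
  rw [hJ'.vac_of_regular hs, hJ.vac_of_regular hr, hJ.vac_of_regular hr, hJ'.vac_of_regular hs, h0]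

/-- Both maps are regular at `z m`, so no residue appears there, and `J'^⁅s, a⁆` cancels the
commutator of the two actions on the `m`-th factor. -/
theorem commute_vac_of_regularAway_of_regular (hz : Function.Injective z) (hlm : l ≠ m)
    {J' : Current 𝔤 →ₗ[ℂ] Module.End ℂ (InducedModule 𝔤 W)}
    (hJ : IsLoopOperator W B z l J) (hJ' : IsLoopOperator W B z m J') {a s : Current 𝔤}
    (ha : RegularAwayFrom (z l) a) (hs : RegularAt (z m) s) (t : ⨂[ℂ] i, W i) :
    J a (J' s (vac 𝔤 W t)) = J' s (J a (vac 𝔤 W t)) := by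
  have ham : RegularAt (z m) a := ha _ (hz.ne hlm.symm)
  have hint : Finset.univ.erase l ∩ {m} = {m} :=
    Finset.inter_singleton_of_mem (Finset.mem_erase.mpr ⟨hlm.symm, Finset.mem_univ m⟩)
  have hcomm := partialAct_evalAll_comm (W := W) (z := z) (S := Finset.univ.erase l) (S' := {m})
    (μ := a) (ν := s) (by simpa [hint] using ham) (by simpa [hint] using hs) t
  rw [hint] at hcomm
  rw [hJ'.vac_of_regular hs, hJ.vac_of_regularAway ha, hJ.vac_of_regularAway ha, map_sub (J' s),
    hJ'.apply_currentAct, hJ'.vac_of_regular hs, hJ'.vac_of_regular hs,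
    hJ'.vac_of_regular (hs.lie ham), resPairing_of_regular B hs ham, hcomm, ← lie_skew s a,
    map_neg (evalAll z), map_neg (partialAct W {m}), LinearMap.neg_apply, map_neg (vac 𝔤 W),
    map_add (vac 𝔤 W), zero_smul]
  abel

/-- The sum of the loop operators around two points, on maps whose poles are at these points. -/
theorem add_vac_of_regular (hz : Function.Injective z) (hlm : l ≠ m)
    {J' : Current 𝔤 →ₗ[ℂ] Module.End ℂ (InducedModule 𝔤 W)}
    (hJ : IsLoopOperator W B z l J) (hJ' : IsLoopOperator W B z m J') {κ : Current 𝔤}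
    (hκ : ∀ q, q ≠ z l → q ≠ z m → RegularAt q κ) (t : ⨂[ℂ] i, W i) :
    J κ (vac 𝔤 W t) + J' κ (vac 𝔤 W t) = currentAct W κ (vac 𝔤 W t) - vac 𝔤 W
      (partialAct W (Finset.univ.erase l ∩ Finset.univ.erase m) (evalAll z κ) t) := by
  obtain ⟨c, d, hc, hd, hdl, rfl⟩ := exists_regularAway_add_regularAway hκ
  have hcm : RegularAt (z m) c := hc _ (hz.ne hlm.symm)
  have h2 := partialAct_singleton_add W hlm.symm (evalAll z d)
  rw [Finset.inter_comm] at h2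
  rw [map_add J, map_add J', LinearMap.add_apply, LinearMap.add_apply,
    hJ.vac_of_regularAway hc, hJ.vac_of_regular hdl, hJ'.vac_of_regular hcm,
    hJ'.vac_of_regularAway hd, ← partialAct_singleton_add W hlm, ← h2,
    map_add (currentAct W), map_add (evalAll z), map_add (partialAct W (_ ∩ _))]
  simp only [LinearMap.add_apply, map_add (vac 𝔤 W)]
  abel

/-- This expansion serves both two distinct points and, with `J' = J`, a single point. -/
theorem apply_apply_vac_of_regularAway {J' : Current 𝔤 →ₗ[ℂ] Module.End ℂ (InducedModule 𝔤 W)}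
    (hJ : IsLoopOperator W B z l J) (hJ' : IsLoopOperator W B z m J') {a b : Current 𝔤}
    (ha : RegularAwayFrom (z l) a) (hb : RegularAwayFrom (z m) b) (t : ⨂[ℂ] i, W i) :
    J a (J' b (vac 𝔤 W t)) = currentAct W b (currentAct W a (vac 𝔤 W t)) -
      currentAct W b (vac 𝔤 W (partialAct W (Finset.univ.erase l) (evalAll z a) t)) +
      J ⁅a, b⁆ (vac 𝔤 W t) + resPairing B (z l) a b • vac 𝔤 W t -
      (currentAct W a (vac 𝔤 W (partialAct W (Finset.univ.erase m) (evalAll z b) t)) -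
        vac 𝔤 W (partialAct W (Finset.univ.erase l) (evalAll z a)
          (partialAct W (Finset.univ.erase m) (evalAll z b) t))) := by
  rw [hJ'.vac_of_regularAway hb, map_sub (J a), hJ.apply_currentAct, hJ.vac_of_regularAway ha,
    hJ.vac_of_regularAway ha, map_sub (currentAct W b)]

/-- In the difference of the two orders, `J^⁅a, b⁆ + J'^⁅a, b⁆` equals left multiplication by `⁅a,
b⁆` minus the action on the factors other than `l` and `m`. These cancel the commutators of the left
multiplications and of the partial actions. The scalars cancel by the residue theorem for two
points. -/
theorem commute_vac_of_regularAway (hz : Function.Injective z) (hB : B.IsSymm) (hlm : l ≠ m)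
    {J' : Current 𝔤 →ₗ[ℂ] Module.End ℂ (InducedModule 𝔤 W)}
    (hJ : IsLoopOperator W B z l J) (hJ' : IsLoopOperator W B z m J') {a b : Current 𝔤}
    (ha : RegularAwayFrom (z l) a) (hb : RegularAwayFrom (z m) b) (t : ⨂[ℂ] i, W i) :
    J a (J' b (vac 𝔤 W t)) = J' b (J a (vac 𝔤 W t)) := by
  have hres : resPairing B (z l) a b = resPairing B (z m) b a := by
    rw [resPairing_skew hB (z m) a b, eq_neg_iff_add_eq_zero]
    exact resPairing_add_resPairing B (hz.ne hlm) ha hb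
  have hsum := hJ.add_vac_of_regular hz hlm hJ'
    (fun q hp hq => (ha q hp).lie (hb q hq) : ∀ q, q ≠ z l → q ≠ z m → RegularAt q ⁅a, b⁆) t
  have hcomm := partialAct_evalAll_comm (W := W) (z := z) (S := Finset.univ.erase l)
    (S' := Finset.univ.erase m) (μ := a) (ν := b)
    (fun i hi => ha.regularAt_erase hz (Finset.mem_inter.mp hi).1)
    (fun i hi => hb.regularAt_erase hz (Finset.mem_inter.mp hi).2) t
  rw [currentAct_lie] at hsum
  rw [hJ.apply_apply_vac_of_regularAway hJ' ha hb, hJ'.apply_apply_vac_of_regularAway hJ hb ha,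
    hcomm, ← lie_skew b a, map_neg J', LinearMap.neg_apply, map_add (vac 𝔤 W), hres,
    eq_sub_of_add_eq hsum]
  abel

/-- Loop operators around different insertion points commute on `1 ⊗ t`. -/
theorem commute_vac (hz : Function.Injective z) (hB : B.IsSymm) (hlm : l ≠ m)
    {J' : Current 𝔤 →ₗ[ℂ] Module.End ℂ (InducedModule 𝔤 W)}
    (hJ : IsLoopOperator W B z l J) (hJ' : IsLoopOperator W B z m J') (ν μ : Current 𝔤)
    (t : ⨂[ℂ] i, W i) : J ν (J' μ (vac 𝔤 W t)) = J' μ (J ν (vac 𝔤 W t)) := by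
  obtain ⟨a, r, ha, hr, rfl⟩ := exists_regularAway_add_regular (z l) ν
  obtain ⟨b, s, hb, hs, rfl⟩ := exists_regularAway_add_regular (z m) μ
  rw [map_add J, map_add J']
  simp only [LinearMap.add_apply, map_add (J a), map_add (J r), map_add (J' b), map_add (J' s)]
  rw [hJ.commute_vac_of_regularAway hz hB hlm hJ' ha hb,
    hJ.commute_vac_of_regular hlm hJ' hr hs,
    hJ.commute_vac_of_regularAway_of_regular hz hlm hJ' ha hs,
    ← hJ'.commute_vac_of_regularAway_of_regular hz hlm.symm hJ hb hr]
  abel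

theorem commute (hz : Function.Injective z) (hB : B.IsSymm) (hlm : l ≠ m)
    {J' : Current 𝔤 →ₗ[ℂ] Module.End ℂ (InducedModule 𝔤 W)}
    (hJ : IsLoopOperator W B z l J) (hJ' : IsLoopOperator W B z m J') (ν μ : Current 𝔤)
    (x : InducedModule 𝔤 W) : J ν (J' μ x) = J' μ (J ν x) := by
  -- Stability under `α` uses commutation for the pairs `(⁅ν, α⁆, μ)` and `(ν, ⁅μ, α⁆)` as well,
  -- hence the intersection over all pairs.
  let N : Submodule ℂ (InducedModule 𝔤 W) :=
    ⨅ p : Current 𝔤 × Current 𝔤, LinearMap.ker (J p.1 * J' p.2 - J' p.2 * J p.1)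
  have hN (x) : x ∈ N ↔ ∀ ν μ, J ν (J' μ x) = J' μ (J ν x) := by
    simp [N, Submodule.mem_iInf, sub_eq_zero]
  refine (hN x).mp (mem_of_forall_vac W (fun t => ?_) (fun α x hx => ?_) x) ν μ
  · exact (hN _).mpr fun ν μ => hJ.commute_vac hz hB hlm hJ' ν μ t
  · rw [hN] at hx ⊢
    intro ν μ
    simp only [hJ.apply_currentAct, hJ'.apply_currentAct, map_add (J _), map_add (J' _),
      map_smul (J _), map_smul (J' _), hx]
    abel

/-- The commutation relation around a single point, for one map regular away from the point and
one regular at the point. -/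
theorem bracket_vac_of_regularAway_of_regular (hB : B.IsSymm)
    (hJ : IsLoopOperator W B z l J) {a s : Current 𝔤} (ha : RegularAwayFrom (z l) a)
    (hs : RegularAt (z l) s) (t : ⨂[ℂ] i, W i) :
    J a (J s (vac 𝔤 W t)) = J s (J a (vac 𝔤 W t)) + J ⁅a, s⁆ (vac 𝔤 W t) +
      resPairing B (z l) a s • vac 𝔤 W t := by
  have hint : Finset.univ.erase l ∩ {l} = ∅ :=
    Finset.inter_singleton_of_notMem (Finset.notMem_erase l _)
  have hcomm := partialAct_evalAll_comm (W := W) (z := z) (S := Finset.univ.erase l) (S' := {l})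
    (μ := a) (ν := s) (by simp [hint]) (by simp [hint]) t
  rw [hint, partialAct_apply W ∅, Finset.sum_empty, LinearMap.zero_apply, add_zero] at hcomm
  rw [hJ.vac_of_regular hs, hJ.vac_of_regularAway ha, hJ.vac_of_regularAway ha, map_sub (J s),
    hJ.apply_currentAct, hJ.vac_of_regular hs, hJ.vac_of_regular hs, hcomm, ← lie_skew s a,
    map_neg J, LinearMap.neg_apply, resPairing_skew hB (z l) a s, neg_smul]
  abel

theorem bracket_vac_of_regular (hJ : IsLoopOperator W B z l J) {r s : Current 𝔤}
    (hr : RegularAt (z l) r) (hs : RegularAt (z l) s) (t : ⨂[ℂ] i, W i) :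
    J r (J s (vac 𝔤 W t)) = J s (J r (vac 𝔤 W t)) + J ⁅r, s⁆ (vac 𝔤 W t) +
      resPairing B (z l) r s • vac 𝔤 W t := by
  have hcomm := partialAct_evalAll_comm (W := W) (z := z) (S := {l}) (S' := {l})
    (μ := r) (ν := s) (by simpa using hr) (by simpa using hs) t
  rw [Finset.inter_self] at hcomm
  rw [hJ.vac_of_regular hs, hJ.vac_of_regular hr, hJ.vac_of_regular hr, hJ.vac_of_regular hs,
    hJ.vac_of_regular (hr.lie hs), hcomm, map_add (vac 𝔤 W), resPairing_of_regular B hr hs,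
    zero_smul, add_zero]

/-- The residues vanish. The difference of the two orders is `2 J^⁅a, b⁆` minus the value that
`regular_away` prescribes for `J^⁅a, b⁆`. -/
theorem bracket_vac_of_regularAway (hz : Function.Injective z) (hJ : IsLoopOperator W B z l J)
    {a b : Current 𝔤} (ha : RegularAwayFrom (z l) a) (hb : RegularAwayFrom (z l) b)
    (t : ⨂[ℂ] i, W i) :
    J a (J b (vac 𝔤 W t)) = J b (J a (vac 𝔤 W t)) + J ⁅a, b⁆ (vac 𝔤 W t) +
      resPairing B (z l) a b • vac 𝔤 W t := by
  have hcomm := partialAct_evalAll_comm (W := W) (z := z) (S := Finset.univ.erase l)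
    (S' := Finset.univ.erase l) (μ := a) (ν := b)
    (fun i hi => ha.regularAt_erase hz (Finset.mem_inter.mp hi).1)
    (fun i hi => hb.regularAt_erase hz (Finset.mem_inter.mp hi).2) t
  rw [Finset.inter_self] at hcomm
  rw [hJ.apply_apply_vac_of_regularAway hJ ha hb, hJ.apply_apply_vac_of_regularAway hJ hb ha,
    hcomm, resPairing_of_regularAway B ha hb, resPairing_of_regularAway B hb ha, ← lie_skew b a,
    map_neg J, LinearMap.neg_apply, hJ.vac_of_regularAway (ha.lie hb), currentAct_lie,
    map_add (vac 𝔤 W), zero_smul]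
  abel

theorem bracket_vac (hz : Function.Injective z) (hB : B.IsSymm) (hJ : IsLoopOperator W B z l J)
    (μ ν : Current 𝔤) (t : ⨂[ℂ] i, W i) :
    J μ (J ν (vac 𝔤 W t)) = J ν (J μ (vac 𝔤 W t)) + J ⁅μ, ν⁆ (vac 𝔤 W t) +
      resPairing B (z l) μ ν • vac 𝔤 W t := by
  obtain ⟨a, r, ha, hr, rfl⟩ := exists_regularAway_add_regular (z l) μ
  obtain ⟨b, s, hb, hs, rfl⟩ := exists_regularAway_add_regular (z l) ν
  have h1 := hJ.bracket_vac_of_regularAway_of_regular hB hb hr t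
  rw [← lie_skew b r, map_neg J, LinearMap.neg_apply, resPairing_skew hB (z l) r b, neg_smul] at h1
  simp only [add_lie, lie_add, map_add J, map_add (resPairing B (z l)), LinearMap.add_apply,
    map_add (J _), map_add (resPairing B (z l) _), add_smul]
  rw [hJ.bracket_vac_of_regularAway hz ha hb, hJ.bracket_vac_of_regular hr hs,
    hJ.bracket_vac_of_regularAway_of_regular hB ha hs, h1]
  abel

theorem bracket (hz : Function.Injective z) (hB : B.IsSymm) (hBinv : B.lieInvariant 𝔤)
    (hJ : IsLoopOperator W B z l J) (μ ν : Current 𝔤) (x : InducedModule 𝔤 W) :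
    J μ (J ν x) = J ν (J μ x) + J ⁅μ, ν⁆ x + resPairing B (z l) μ ν • x := by
  let N : Submodule ℂ (InducedModule 𝔤 W) := ⨅ p : Current 𝔤 × Current 𝔤, LinearMap.ker
    (J p.1 * J p.2 - (J p.2 * J p.1 + J ⁅p.1, p.2⁆ + resPairing B (z l) p.1 p.2 • 1))
  have hN (x) : x ∈ N ↔ ∀ μ ν,
      J μ (J ν x) = J ν (J μ x) + J ⁅μ, ν⁆ x + resPairing B (z l) μ ν • x := by
    simp [N, Submodule.mem_iInf, sub_eq_zero]
  refine (hN x).mp (mem_of_forall_vac W (fun t => ?_) (fun α x hx => ?_) x) μ ν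
  · exact (hN _).mpr fun μ ν => hJ.bracket_vac hz hB μ ν t
  · rw [hN] at hx ⊢
    intro μ ν
    -- Passing from `x` to `α x`, the scalar terms match by the cocycle identity and the terms in
    -- `J` by the Jacobi identity.
    have hcoc := resPairing_cocycle hBinv (z l) μ ν α
    rw [resPairing_skew hB (z l) ⁅μ, α⁆ ν] at hcoc
    have hjac : J ⁅μ, ⁅ν, α⁆⁆ x = J ⁅⁅μ, ν⁆, α⁆ x - J ⁅⁅μ, α⁆, ν⁆ x := by
      rw [leibniz_lie μ ν α, ← lie_skew ⁅μ, α⁆ ν, map_add J, map_neg J, LinearMap.add_apply,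
        LinearMap.neg_apply, sub_neg_eq_add]
    simp only [hJ.apply_currentAct, map_add (J _), map_smul (J _)]
    rw [hx μ ν, hx μ ⁅ν, α⁆, hx ⁅μ, α⁆ ν, hcoc, hjac]
    simp only [map_add (currentAct W α), map_smul (currentAct W α), add_smul, neg_smul]
    abel

end IsLoopOperator

end LoopOperators

/-! ### The central extension -/

section CentralExtension

open LieModule.Cohomology

variable {𝔤 : Type*} [LieRing 𝔤] [LieAlgebra ℂ 𝔤]

/-- The residue pairing as a 2-cocycle with values in the trivial module. -/
def resCocycle {B : LinearMap.BilinForm ℂ 𝔤} (hB : B.IsSymm) (hBinv : B.lieInvariant 𝔤)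
    (p : OnePoint ℂ) :
    twoCocycle ℂ (Current 𝔤) (TrivialLieModule ℂ (Current 𝔤) ℂ) :=
  ⟨⟨(resPairing B p).compr₂ (TrivialLieModule.equiv ℂ (Current 𝔤) ℂ).symm.toLinearMap,
    fun μ => by
      change (TrivialLieModule.equiv ℂ (Current 𝔤) ℂ).symm (resPairing B p μ μ) = 0
      rw [resPairing_self hB, map_zero]⟩,
    (mem_twoCocycle_iff_of_trivial ℂ (Current 𝔤) _ _).mpr fun μ ν α => by
      change (TrivialLieModule.equiv ℂ (Current 𝔤) ℂ).symm (resPairing B p μ ⁅ν, α⁆) =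
        (TrivialLieModule.equiv ℂ (Current 𝔤) ℂ).symm (resPairing B p ⁅μ, ν⁆ α) +
        (TrivialLieModule.equiv ℂ (Current 𝔤) ℂ).symm (resPairing B p ν ⁅μ, α⁆)
      rw [resPairing_cocycle hBinv, map_add]⟩

theorem equiv_resCocycle {B : LinearMap.BilinForm ℂ 𝔤} (hB : B.IsSymm)
    (hBinv : B.lieInvariant 𝔤) (p : OnePoint ℂ) (μ ν : Current 𝔤) :
    TrivialLieModule.equiv ℂ (Current 𝔤) ℂ ((resCocycle hB hBinv p : twoCochain ℂ
      (Current 𝔤) (TrivialLieModule ℂ (Current 𝔤) ℂ)) μ ν) = resPairing B p μ ν := rfl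

/-- A linear map that satisfies a commutation relation with a cocycle gives a representation of
the central extension. -/
theorem exists_rep_ofTwoCocycle {L M : Type*} [LieRing L] [LieAlgebra ℂ L] [AddCommGroup M]
    [Module ℂ M] (c : twoCocycle ℂ L (TrivialLieModule ℂ L ℂ)) (J : L →ₗ[ℂ] Module.End ℂ M)
    (hJ : ∀ x y, ⁅J x, J y⁆ = J ⁅x, y⁆ + TrivialLieModule.equiv ℂ L ℂ
      ((c : twoCochain ℂ L (TrivialLieModule ℂ L ℂ)) x y) • (1 : Module.End ℂ M)) :
    ∃ ρ : LieAlgebra.ofTwoCocycle c →ₗ⁅ℂ⁆ Module.End ℂ M, ∀ (x : L) (a : ℂ),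
      ρ (LieAlgebra.ofProd c (x, (TrivialLieModule.equiv ℂ L ℂ).symm a)) = J x + a • 1 := by
  refine ⟨
    { toFun := fun x => J ((LieAlgebra.ofProd c).symm x).1 +
        TrivialLieModule.equiv ℂ L ℂ ((LieAlgebra.ofProd c).symm x).2 • 1
      map_add' := fun x y => by
        rw [LieAlgebra.of_symm_add, Prod.fst_add, Prod.snd_add, map_add, map_add, add_smul]
        abel
      map_smul' := fun a x => by
        rw [LieAlgebra.of_symm_smul, Prod.smul_fst, Prod.smul_snd, map_smul, map_smul,
          smul_assoc, RingHom.id_apply, smul_add]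
      map_lie' := fun {x y} => ?_ }, fun x a => rfl⟩
  rw [LieAlgebra.bracket_ofTwoCocycle]
  simp only [Equiv.symm_apply_apply, trivial_lie_zero, add_zero, sub_zero]
  have hone (f : Module.End ℂ M) (a : ℂ) : ⁅f, a • (1 : Module.End ℂ M)⁆ = 0 := by
    simp [LieRing.of_associative_ring_bracket]
  have hone' (f : Module.End ℂ M) (a : ℂ) : ⁅a • (1 : Module.End ℂ M), f⁆ = 0 := by
    simp [LieRing.of_associative_ring_bracket]
  rw [lie_add, hone, add_zero, add_lie, hone', add_zero, hJ]
  rfl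

end CentralExtension

end LoopCurrent
end

/-! ### The theorem on loop operators -/

theorem mainTheorem10 {𝔤 : Type*} [LieRing 𝔤] [LieAlgebra ℂ 𝔤]
    (B : LinearMap.BilinForm ℂ 𝔤) (hBsymm : B.IsSymm) (hBinv : B.lieInvariant 𝔤)
    {n : ℕ} (W : Fin n → Type*) [∀ j, AddCommGroup (W j)] [∀ j, Module ℂ (W j)]
    [∀ j, LieRingModule 𝔤 (W j)] [∀ j, LieModule ℂ 𝔤 (W j)]
    (z : Fin n → OnePoint ℂ) (hz : Function.Injective z) :
    ∃ J : Fin n → LoopCurrent.Current 𝔤 →ₗ[ℂ] Module.End ℂ (LoopCurrent.InducedModule 𝔤 W),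
      -- the defining equations determine the loop operators
      (∀ l, LoopCurrent.IsLoopOperator W B z l (J l) ∧
        ∀ J', LoopCurrent.IsLoopOperator W B z l J' → J' = J l) ∧
      -- loop operators around different insertion points commute
      (∀ l m, l ≠ m → ∀ ν₁ ν₂ : LoopCurrent.Current 𝔤, ⁅J l ν₁, J m ν₂⁆ = 0) ∧
      -- the commutator of loop operators around a single insertion point
      (∀ l, ∀ μ ν : LoopCurrent.Current 𝔤,
        ⁅J l μ, J l ν⁆ - J l ⁅μ, ν⁆ =
          LoopCurrent.resPairing B (z l) μ ν •
            (1 : Module.End ℂ (LoopCurrent.InducedModule 𝔤 W))) ∧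
      (∀ l, ∀ μ ν : LoopCurrent.Current 𝔤,
        (LoopCurrent.RegularAt (z l) μ ∧ LoopCurrent.RegularAt (z l) ν) ∨
          (LoopCurrent.RegularAwayFrom (z l) μ ∧ LoopCurrent.RegularAwayFrom (z l) ν) →
        ⁅J l μ, J l ν⁆ - J l ⁅μ, ν⁆ = 0) ∧
      -- the residue is a 2-cocycle, and the loop operators around a single insertion point
      -- are a representation of the central extension that it defines
      (∀ l, ∃ c : LieModule.Cohomology.twoCocycle ℂ (LoopCurrent.Current 𝔤)
            (TrivialLieModule ℂ (LoopCurrent.Current 𝔤) ℂ),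
        (∀ μ ν : LoopCurrent.Current 𝔤,
          TrivialLieModule.equiv ℂ (LoopCurrent.Current 𝔤) ℂ ((c : LieModule.Cohomology.twoCochain ℂ
            (LoopCurrent.Current 𝔤) (TrivialLieModule ℂ (LoopCurrent.Current 𝔤) ℂ)) μ ν) =
              LoopCurrent.resPairing B (z l) μ ν) ∧
        ∃ ρ : LieAlgebra.ofTwoCocycle c →ₗ⁅ℂ⁆ Module.End ℂ (LoopCurrent.InducedModule 𝔤 W),
          ∀ (ν : LoopCurrent.Current 𝔤) (a : ℂ),
            ρ (LieAlgebra.ofProd c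
                (ν, (TrivialLieModule.equiv ℂ (LoopCurrent.Current 𝔤) ℂ).symm a)) =
              J l ν + a • 1) := by
  choose J hJ using fun l : Fin n =>
    LoopCurrent.exists_isLoopOperator (W := W) (z := z) hBsymm hBinv l
  have hbracket (l : Fin n) (μ ν : LoopCurrent.Current 𝔤) : ⁅J l μ, J l ν⁆ = J l ⁅μ, ν⁆ +
      LoopCurrent.resPairing B (z l) μ ν •
        (1 : Module.End ℂ (LoopCurrent.InducedModule 𝔤 W)) := by
    refine LinearMap.ext fun x => ?_
    rw [LieRing.of_associative_ring_bracket]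
    change J l μ (J l ν x) - J l ν (J l μ x) =
      J l ⁅μ, ν⁆ x + LoopCurrent.resPairing B (z l) μ ν • x
    rw [(hJ l).bracket hz hBsymm hBinv]
    abel
  refine ⟨J, fun l => ⟨hJ l, fun J' hJ' => (hJ l).unique hJ'⟩, fun l m hlm ν₁ ν₂ => ?_,
    fun l μ ν => ?_, fun l μ ν h => ?_, fun l => ⟨LoopCurrent.resCocycle hBsymm hBinv (z l),
      LoopCurrent.equiv_resCocycle hBsymm hBinv (z l), ?_⟩⟩
  · refine LinearMap.ext fun x => ?_
    rw [LieRing.of_associative_ring_bracket]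
    exact sub_eq_zero.mpr ((hJ l).commute hz hBsymm hlm (hJ m) ν₁ ν₂ x)
  · rw [hbracket, add_sub_cancel_left]
  · rw [hbracket, add_sub_cancel_left]
    rcases h with ⟨hμ, hν⟩ | ⟨hμ, hν⟩
    · rw [LoopCurrent.resPairing_of_regular B hμ hν, zero_smul]
    · rw [LoopCurrent.resPairing_of_regularAway B hμ hν, zero_smul]
  · exact LoopCurrent.exists_rep_ofTwoCocycle _ (J l) (hbracket l)
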